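/- All graphs are finite and simple; $|G|$, $\alpha(G)$, $\omega(G)$ denote the number of vertices of $G$, the size of its largest stable set and the size of its largest clique, and $\overline{G}$ denotes its complement. For a set $\mathcal{H}$ of graphs, a graph $G$ is $\mathcal{H}$-free if no induced subgraph of $G$ is isomorphic to a member of $\mathcal{H}$. The set $\mathcal{H}$ has the Erdős–Hajnal property if there exists $\tau>0$ such that $\max(\alpha(G),\omega(G))\ge |G|^{\tau}$ for every $\mathcal{H}$-free graph $G$; a graph $H$ has the property if $\{H\}$ does. For $k\ge 4$ let $\widehat{C_k}$ be the graph obtained from the cycle $C_k$ of length $k$ by adding a new vertex whose neighbours are exactly two adjacent vertices of the cycle. Let $P_k$ be the path with $k$ vertices, and let the bull be the graph obtained from $P_4$ by adding a new vertex whose neighbours are exactly its two central vertices. **Theorem.** The set $\{\widehat{C_5},\overline{\widehat{C_5}}\}$ has the Erdős–Hajnal property. Consequently: 1. the bull has the Erdős–Hajnal property; 2. $\{\widehat{C_5},\overline{P_5}\}$ has the Erdős–Hajnal property; 3. the set $\{\widehat{C_k} : k\ge 4\}$ of all "hole-with-hat" graphs has the Erdős–Hajnal property. -/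

import Mathlib

namespace ErdosHajnal

/-- A graph bundled with its vertex type, so that sets of graphs can be formed. -/
abbrev BundledGraph : Type 1 := Σ V : Type, SimpleGraph V

/-- `G` is free of the set `F` of graphs: no member of `F` is isomorphic to an induced
subgraph of `G`. -/
def IsFree {V : Type} (G : SimpleGraph V) (F : Set BundledGraph) : Prop :=
  ∀ H ∈ F, ¬ H.2.IsIndContained G

/-- A set `F` of graphs has the Erdős–Hajnal property: for some `τ > 0`, every finite `F`-free
graph `G` satisfies `max (α(G), ω(G)) ≥ |G| ^ τ`. -/
def HasEHProperty (F : Set BundledGraph) : Prop :=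
  ∃ τ : ℝ, 0 < τ ∧ ∀ (V : Type) [Fintype V] (G : SimpleGraph V), IsFree G F →
    (Fintype.card V : ℝ) ^ τ ≤ ((max G.indepNum G.cliqueNum : ℕ) : ℝ)

/-- The graph obtained from `G` by adding a new vertex `none`, whose neighbours are exactly
the vertices in `S`. -/
def addVertex {V : Type} (G : SimpleGraph V) (S : Set V) : SimpleGraph (Option V) where
  Adj x y :=
    match x, y with
    | none, none => False
    | none, some v => v ∈ S
    | some u, none => u ∈ S
    | some u, some v => G.Adj u v
  symm := ⟨by
    rintro (_ | u) (_ | v) h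
    · exact h
    · exact h
    · exact h
    · exact G.adj_symm h⟩
  loopless := ⟨by
    rintro (_ | u) h
    · exact h
    · exact G.irrefl h⟩

/-- For `k ≥ 3`: the cycle with vertices `0, …, k - 1`, with a new vertex whose neighbours are
exactly the two adjacent vertices `0` and `1` of the cycle. -/
def cycleHat (k : ℕ) : SimpleGraph (Option (Fin k)) :=
  addVertex (SimpleGraph.cycleGraph k) {i | i.val = 0 ∨ i.val = 1}

/-- The bull: the path with vertices `0, 1, 2, 3`, with a new vertex whose neighbours are
exactly the two central vertices `1` and `2`. -/
def bull : SimpleGraph (Option (Fin 4)) :=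
  addVertex (SimpleGraph.pathGraph 4) {i | i.val = 1 ∨ i.val = 2}

end ErdosHajnal

/-!
Let `G` be a graph such that neither `G` nor `Gᶜ` has an induced five-cycle with a hat. By
Rödl's theorem (`exists_sparse_subset`) some linear part of `G` is very sparse in `G` or in `Gᶜ`,
and both graphs satisfy the same hypothesis `NoHat`. The heart of the argument is that a sparse
set `X₀` in such a graph contains a *blockade*: for some `q ≥ 2`, there are `q` pairwise
anticomplete subsets of size at least `|X₀| / q ^ C` (`exists_hasBlockade_of_sparse`). Induction
inside these subsets yields a stable set `A` and a clique `B` with `|V| ≤ (|A| |B|) ^ C`, since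
stable sets of anticomplete parts can be united, and dually in the complement.

To find a blockade, take `S ⊆ X₀` maximizing `|S| ^ 2 / D`, where `D` bounds the degrees in `S`,
among sufficiently sparse sets, and let `q ^ m ≈ |S| / D`. Maximality says that every large
subset of `S` still has a vertex whose degree is about `D`, and that even subsets of size about
`D` have vertices of degree at least `|S| / q ^ C`. There are two cases.

* Some vertex `v` has many neighbours `a i` with large private neighbourhoods `B i`, anticomplete
  to `v` and to the other `a j`. In such a comb (`IsComb`), if few of the `B i` are attached to
  each other, pruning gives a blockade. Otherwise some `B i` is attached to many `B j`. If
  `a j` is adjacent to `a i` for many of these, then adjacent vertices in different `B j` have the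
  same neighbours in `B i`, since otherwise `v` is a hat; a fair division (`exists_fair_division`)
  of the attached vertices by index and by neighbourhood in `B i` gives anticomplete sets. If not,
  the teeth `a j` can be taken pairwise non-adjacent, stars inside the `B j` are pairwise complete
  or anticomplete, and no three are pairwise complete, so many are anticomplete.
* Otherwise, the neighbourhoods of the neighbours of any `w` are nearly contained in one set `Y w`
  of size at most `q ^ 48 * D` (`exists_small_cover`). After deleting the vertices in too many
  `Y w`, each vertex has common neighbours with few others, so `q` anticomplete neighbourhoods
  can be chosen greedily (`hasBlockade_of_cover`).

The other three assertions follow because each member of `{Ĉ₅, Ĉ₅ᶜ}` contains a member of the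
set in question (`hasEHProperty_mono`).
-/

namespace ErdosHajnal

section

open scoped Classical

/-! ### Neighbourhoods, blockades and two selection lemmas -/

/-- The neighbours of `v` that lie in the finite set `S`. -/
noncomputable def nbrIn {V : Type} (G : SimpleGraph V) (v : V) (S : Finset V) : Finset V :=
  S.filter (G.Adj v)

/-- The vertices of `S` with a neighbour in `Q`. -/
noncomputable def nbrOf {V : Type} (G : SimpleGraph V) (Q S : Finset V) : Finset V :=
  S.filter fun y => ∃ x ∈ Q, G.Adj x y

theorem mem_nbrIn {V : Type} {G : SimpleGraph V} {v y : V} {S : Finset V} :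
    y ∈ nbrIn G v S ↔ y ∈ S ∧ G.Adj v y := by
  simp [nbrIn]

theorem mem_nbrOf {V : Type} {G : SimpleGraph V} {y : V} {Q S : Finset V} :
    y ∈ nbrOf G Q S ↔ y ∈ S ∧ ∃ x ∈ Q, G.Adj x y := by
  simp [nbrOf]

theorem nbrIn_mono {V : Type} (G : SimpleGraph V) (v : V) {S T : Finset V} (h : S ⊆ T) :
    nbrIn G v S ⊆ nbrIn G v T :=
  Finset.filter_subset_filter _ h

theorem nbrIn_subset {V : Type} (G : SimpleGraph V) (v : V) (S : Finset V) : nbrIn G v S ⊆ S :=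
  Finset.filter_subset _ _

theorem sum_card_nbrIn_comm {V : Type} (G : SimpleGraph V) (A B : Finset V) :
    ∑ x ∈ A, (nbrIn G x B).card = ∑ y ∈ B, (nbrIn G y A).card := by
  have h := Finset.sum_card_bipartiteAbove_eq_sum_card_bipartiteBelow (s := A) (t := B)
    (fun x y => G.Adj x y)
  simpa [nbrIn, Finset.bipartiteAbove, Finset.bipartiteBelow, G.adj_comm] using h

/-- `G` has no induced five-cycle `c₀c₁c₂c₃c₄` with a hat `h` on the edge `c₀c₁`. The listed
adjacencies and non-adjacencies force the six vertices to be distinct. -/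
def NoHat {V : Type} (G : SimpleGraph V) : Prop :=
  ∀ c₀ c₁ c₂ c₃ c₄ h : V,
    G.Adj c₀ c₁ → G.Adj c₁ c₂ → G.Adj c₂ c₃ → G.Adj c₃ c₄ → G.Adj c₄ c₀ →
    ¬ G.Adj c₀ c₂ → ¬ G.Adj c₀ c₃ → ¬ G.Adj c₁ c₃ → ¬ G.Adj c₁ c₄ → ¬ G.Adj c₂ c₄ →
    G.Adj h c₀ → G.Adj h c₁ → ¬ G.Adj h c₂ → ¬ G.Adj h c₃ → ¬ G.Adj h c₄ → False

/-- There are `q` pairwise disjoint and pairwise anticomplete subsets of `S`, each of size at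
least `|S| / q ^ C`. -/
def HasBlockade {V : Type} (G : SimpleGraph V) (S : Finset V) (q C : ℕ) : Prop :=
  ∃ X : Fin q → Finset V, (∀ i, X i ⊆ S) ∧ (∀ i, S.card ≤ q ^ C * (X i).card) ∧
    ∀ i j, i ≠ j → Disjoint (X i) (X j) ∧ ∀ x ∈ X i, ∀ y ∈ X j, ¬ G.Adj x y

theorem HasBlockade.of_finset {V ι : Type} {G : SimpleGraph V} {S : Finset V} {q C : ℕ}
    (I : Finset ι) (hI : q ≤ I.card) (X : ι → Finset V) (hS : ∀ i ∈ I, X i ⊆ S)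
    (hc : ∀ i ∈ I, S.card ≤ q ^ C * (X i).card)
    (hd : ∀ i ∈ I, ∀ j ∈ I, i ≠ j → Disjoint (X i) (X j))
    (ha : ∀ i ∈ I, ∀ j ∈ I, i ≠ j → ∀ x ∈ X i, ∀ y ∈ X j, ¬ G.Adj x y) :
    HasBlockade G S q C := by
  have e : Fin q ↪ I := (Fin.castLEEmb hI).trans I.equivFin.symm.toEmbedding
  refine ⟨fun i => X (e i), fun i => hS _ (e i).2, fun i => hc _ (e i).2, fun i j hij => ?_⟩
  have : (e i : ι) ≠ e j := fun h => hij (e.injective (Subtype.ext h))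
  exact ⟨hd _ (e i).2 _ (e j).2 this, ha _ (e i).2 _ (e j).2 this⟩

/-- A directed graph with all out-degrees at most `d` has a large independent set: some vertex
has in-degree at most `d`, and it can be chosen greedily. -/
theorem exists_independent {ι : Type} (r : ι → ι → Prop) (d : ℕ) (s : ℕ) :
    ∀ I : Finset ι, (∀ i ∈ I, (I.filter fun j => j ≠ i ∧ r i j).card ≤ d) →
      s * (2 * d + 1) ≤ I.card →
      ∃ J ⊆ I, J.card = s ∧ ∀ i ∈ J, ∀ j ∈ J, i ≠ j → ¬ r i j := by
  induction s with
  | zero => exact fun I _ _ => ⟨∅, by simp, by simp, by simp⟩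
  | succ s ih =>
    intro I hI hc
    have hpos : 0 < I.card := by
      have : 0 < (s + 1) * (2 * d + 1) := by positivity
      omega
    obtain ⟨v, hv, hvd⟩ : ∃ v ∈ I, (I.filter fun i => v ≠ i ∧ r i v).card ≤ d := by
      by_contra! hcon
      have h1 := Finset.sum_card_bipartiteAbove_eq_sum_card_bipartiteBelow (s := I) (t := I)
        (fun i j => j ≠ i ∧ r i j)
      have h2 : ∑ i ∈ I, (I.filter fun j => j ≠ i ∧ r i j).card ≤ I.card * d := by
        simpa using Finset.sum_le_card_nsmul I _ d hI
      have h3 : I.card * (d + 1) ≤ ∑ j ∈ I, (I.filter fun i => j ≠ i ∧ r i j).card := by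
        simpa using Finset.card_nsmul_le_sum I _ (d + 1) fun j hj => hcon j hj
      simp only [Finset.bipartiteAbove, Finset.bipartiteBelow] at h1
      have : I.card * d < I.card * (d + 1) := by gcongr; omega
      omega
    set O := I.filter fun j => j ≠ v ∧ r v j
    set U := I.filter fun i => v ≠ i ∧ r i v
    set I' := ((I \ O) \ U).erase v with hI'
    have hcard : I.card ≤ I'.card + (2 * d + 1) := by
      have a1 := Finset.le_card_sdiff O I
      have a2 := Finset.le_card_sdiff U (I \ O)
      have a3 := Finset.pred_card_le_card_erase (s := (I \ O) \ U) (a := v)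
      have a4 := hI v hv
      rw [← hI'] at a3
      change O.card ≤ d at a4
      omega
    have hsub : I' ⊆ I := fun x hx => by
      simp only [hI', Finset.mem_erase, Finset.mem_sdiff] at hx; exact hx.2.1.1
    obtain ⟨J, hJ, hJc, hJi⟩ := ih I' (fun i hi =>
      (Finset.card_le_card (Finset.filter_subset_filter _ hsub)).trans (hI i (hsub hi))) (by
        have : (s + 1) * (2 * d + 1) = s * (2 * d + 1) + (2 * d + 1) := by ring
        omega)
    have hfree : ∀ j ∈ J, j ≠ v ∧ ¬ r v j ∧ ¬ r j v := by
      intro j hj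
      have hx := hJ hj
      simp only [hI', O, U, Finset.mem_erase, Finset.mem_sdiff, Finset.mem_filter] at hx
      obtain ⟨h1, ⟨h2, h3⟩, h4⟩ := hx
      exact ⟨h1, fun h => h3 ⟨h2, h1, h⟩, fun h => h4 ⟨h2, h1.symm, h⟩⟩
    refine ⟨insert v J, ?_, ?_, ?_⟩
    · exact Finset.insert_subset hv (hJ.trans hsub)
    · rw [Finset.card_insert_of_notMem fun h => (hfree v h).1 rfl, hJc]
    · intro i hi j hj hij
      rcases Finset.mem_insert.1 hi with rfl | hi' <;>
        rcases Finset.mem_insert.1 hj with rfl | hj'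
      · exact absurd rfl hij
      · exact (hfree j hj').2.1
      · exact (hfree i hi').2.2
      · exact hJi i hi' j hj' hij

/-- Deleting `|J|` sets, each of size at most `|B| / (2 |J|)`, leaves at least half of `B`. -/
theorem card_le_two_mul_card_sdiff {V ι : Type} (B : Finset V) (J : Finset ι)
    (Z : ι → Finset V) (h : ∀ i ∈ J, 2 * J.card * (Z i).card ≤ B.card) :
    B.card ≤ 2 * (B \ J.biUnion Z).card := by
  rcases J.eq_empty_or_nonempty with rfl | hJ
  · simp; omega
  have h1 : (J.biUnion Z).card ≤ ∑ i ∈ J, (Z i).card := Finset.card_biUnion_le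
  have h2 : 2 * J.card * ∑ i ∈ J, (Z i).card ≤ J.card * B.card := by
    rw [Finset.mul_sum]
    simpa using Finset.sum_le_card_nsmul J _ B.card h
  have h3 := Finset.le_card_sdiff (J.biUnion Z) B
  have h4 : 2 * ∑ i ∈ J, (Z i).card ≤ B.card := by
    have : 0 < J.card := hJ.card_pos
    refine Nat.le_of_mul_le_mul_left ?_ this
    linarith [h2]
  omega

/-- A discrete moving knife: if every claimant `h ∈ H` values the goods in `R` at `2D|H|` in
total and each single good at no more than `D`, then every claimant can be given goods that it
values at `D`. A minimal bundle that satisfies someone is worth at most `2D` to everyone. -/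
theorem exists_fair_division {κ ρ : Type} (D : ℕ) (hD : 0 < D) (μ : κ → ρ → ℕ)
    (H : Finset κ) : ∀ R : Finset ρ,
      (∀ h ∈ H, ∀ x ∈ R, μ h x ≤ D) → (∀ h ∈ H, 2 * D * H.card ≤ ∑ x ∈ R, μ h x) →
      ∃ f : κ → Finset ρ, (∀ h ∈ H, f h ⊆ R ∧ D ≤ ∑ x ∈ f h, μ h x) ∧
        ∀ h ∈ H, ∀ h' ∈ H, h ≠ h' → Disjoint (f h) (f h') := by
  induction hn : H.card generalizing H with
  | zero =>
    intro R _ _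
    rw [Finset.card_eq_zero] at hn
    subst hn
    exact ⟨fun _ => ∅, by simp, by simp⟩
  | succ n ih =>
    intro R hμ hs
    have hex : ∃ T ∈ R.powerset, ∃ h ∈ H, D ≤ ∑ x ∈ T, μ h x := by
      obtain ⟨h, hh⟩ : H.Nonempty := Finset.card_pos.1 (by omega)
      refine ⟨R, by simp, h, hh, le_trans ?_ (hs h hh)⟩
      nlinarith
    obtain ⟨T, hT, hmin⟩ := Finset.exists_min_image
      (R.powerset.filter fun T => ∃ h ∈ H, D ≤ ∑ x ∈ T, μ h x) Finset.card
      (by obtain ⟨T, h1, h2⟩ := hex; exact ⟨T, Finset.mem_filter.2 ⟨h1, h2⟩⟩)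
    rw [Finset.mem_filter, Finset.mem_powerset] at hT
    obtain ⟨hTR, h₀, hh₀, hT₀⟩ := hT
    obtain ⟨a, ha⟩ : T.Nonempty := by
      rw [Finset.nonempty_iff_ne_empty]; rintro rfl; simp at hT₀; omega
    have hle : ∀ h ∈ H, ∑ x ∈ T, μ h x ≤ 2 * D := by
      intro h hh
      have h1 : ∑ x ∈ T.erase a, μ h x < D := by
        by_contra! hcon
        have := hmin (T.erase a) (Finset.mem_filter.2
          ⟨Finset.mem_powerset.2 ((Finset.erase_subset _ _).trans hTR), h, hh, hcon⟩)
        have := Finset.card_erase_lt_of_mem ha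
        omega
      have h2 := Finset.add_sum_erase T (μ h) ha
      have h3 := hμ h hh a (hTR ha)
      omega
    obtain ⟨f, hf, hfd⟩ := ih (H.erase h₀) (by rw [Finset.card_erase_of_mem hh₀]; omega) (R \ T)
      (fun h hh x hx => hμ h (Finset.mem_of_mem_erase hh) x (Finset.mem_sdiff.1 hx).1)
      (fun h hh => by
        have h1 := hs h (Finset.mem_of_mem_erase hh)
        have h2 := hle h (Finset.mem_of_mem_erase hh)
        have h3 := Finset.sum_sdiff hTR (f := μ h)
        have h4 : 2 * D * (n + 1) = 2 * D * n + 2 * D := by ring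
        omega)
    refine ⟨Function.update f h₀ T, fun h hh => ?_, fun h hh h' hh' hne => ?_⟩
    · by_cases e : h = h₀
      · subst e; simpa using ⟨hTR, hT₀⟩
      · have := hf h (Finset.mem_erase.2 ⟨e, hh⟩)
        simpa [Function.update_of_ne e] using ⟨this.1.trans Finset.sdiff_subset, this.2⟩
    · have key : ∀ k ∈ H, k ≠ h₀ → Disjoint T (f k) := fun k hk e =>
        (Finset.disjoint_sdiff).mono_right (hf k (Finset.mem_erase.2 ⟨e, hk⟩)).1
      by_cases e : h = h₀
      · subst e
        rw [Function.update_self, Function.update_of_ne hne.symm]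
        exact key h' hh' hne.symm
      · by_cases e' : h' = h₀
        · subst e'
          rw [Function.update_self, Function.update_of_ne e]
          exact (key h hh e).symm
        · rw [Function.update_of_ne e, Function.update_of_ne e']
          exact hfd h (Finset.mem_erase.2 ⟨e, hh⟩) h' (Finset.mem_erase.2 ⟨e', hh'⟩) hne

/-! ### Combs -/

/-- A comb with apex `v`: each tooth `a i` is adjacent to `v` and complete to `B i`, and there
are no edges from `v` to any `B i`, or from a tooth `a i` to `B j` with `j ≠ i`. -/
structure IsComb {V ι : Type} (G : SimpleGraph V) (v : V) (I : Finset ι) (a : ι → V)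
    (B : ι → Finset V) : Prop where
  apex_adj : ∀ i ∈ I, G.Adj v (a i)
  adj : ∀ i ∈ I, ∀ y ∈ B i, G.Adj (a i) y
  apex_not_adj : ∀ i ∈ I, ∀ y ∈ B i, ¬ G.Adj v y
  not_adj : ∀ i ∈ I, ∀ j ∈ I, i ≠ j → ∀ y ∈ B j, ¬ G.Adj (a i) y

namespace IsComb

variable {V ι : Type} {G : SimpleGraph V} {v : V} {I : Finset ι} {a : ι → V} {B : ι → Finset V}

theorem mono (h : IsComb G v I a B) {J : Finset ι} (hJ : J ⊆ I) : IsComb G v J a B where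
  apex_adj i hi := h.apex_adj i (hJ hi)
  adj i hi := h.adj i (hJ hi)
  apex_not_adj i hi := h.apex_not_adj i (hJ hi)
  not_adj i hi j hj := h.not_adj i (hJ hi) j (hJ hj)

theorem disjoint (h : IsComb G v I a B) {i j : ι} (hi : i ∈ I) (hj : j ∈ I) (hij : i ≠ j) :
    Disjoint (B i) (B j) :=
  Finset.disjoint_left.2 fun y hy hy' => h.not_adj i hi j hj hij y hy' (h.adj i hi y hy)

/-- If all teeth are adjacent to `a i`, then two adjacent vertices in different `B j` have the
same neighbours in `B i`; otherwise `v` is a hat on a five-cycle. -/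
theorem nbrIn_eq (h : IsComb G v I a B) (hG : NoHat G) {i j l : ι} (hi : i ∈ I) (hj : j ∈ I)
    (hl : l ∈ I) (hij : j ≠ i) (hil : l ≠ i) (hjl : j ≠ l) (aj : G.Adj (a i) (a j))
    (al : G.Adj (a i) (a l)) {y s : V} (hy : y ∈ B j) (hs : s ∈ B l) (hys : G.Adj y s) :
    nbrIn G y (B i) = nbrIn G s (B i) := by
  have key : ∀ j ∈ I, ∀ l ∈ I, j ≠ i → l ≠ i → j ≠ l → G.Adj (a i) (a j) → ∀ y ∈ B j,
      ∀ s ∈ B l, G.Adj y s → nbrIn G s (B i) ⊆ nbrIn G y (B i) := by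
    intro j hj l hl hij hil hjl aj y hy s hs hys b hb
    rw [mem_nbrIn] at hb ⊢
    refine ⟨hb.1, ?_⟩
    by_contra hyb
    exact hG (a i) (a j) y s b v aj (h.adj j hj y hy) hys hb.2 (h.adj i hi b hb.1).symm
      (h.not_adj i hi j hj hij.symm y hy) (h.not_adj i hi l hl hil.symm s hs)
      (h.not_adj j hj l hl hjl s hs) (h.not_adj j hj i hi hij b hb.1) hyb
      (h.apex_adj i hi) (h.apex_adj j hj) (h.apex_not_adj j hj y hy)
      (h.apex_not_adj l hl s hs) (h.apex_not_adj i hi b hb.1)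
  exact (key l hl j hj hil hij hjl.symm al s hs y hy hys.symm).antisymm
    (key j hj l hl hij hil hjl aj y hy s hs hys)

/-- Many sets `B j` with teeth adjacent to `a i`, each with a considerable part attached to
`B i`, give a blockade: the attached vertices are divided both by `j` and by their set of
neighbours in `B i`. -/
theorem hasBlockade_of_adj (h : IsComb G v I a B) (hG : NoHat G) {S : Finset V} {D q C : ℕ}
    (hD : 0 < D) (hq : 0 < q) (hmax : ∀ x ∈ S, (nbrIn G x S).card ≤ D)
    (hSC : S.card ≤ q ^ C * D) (hBS : ∀ i ∈ I, B i ⊆ S) (haS : ∀ i ∈ I, a i ∈ S)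
    (hB : ∀ i ∈ I, D ≤ 256 * (B i).card) {i : ι} (hi : i ∈ I) {J : Finset ι} (hJI : J ⊆ I)
    (hiJ : i ∉ J) (hJ : 2048 * q ^ 3 ≤ J.card) (ha : ∀ j ∈ J, G.Adj (a i) (a j))
    (hl : ∀ j ∈ J, (B j).card ≤ 2 * q * (nbrOf G (B i) (B j)).card) :
    HasBlockade G S q C := by
  set P : ι → Finset V := fun j => nbrOf G (B i) (B j) with hP
  have hPB : ∀ j, P j ⊆ B j := fun j => Finset.filter_subset _ _
  have hne : ∀ j ∈ J, j ≠ i := fun j hj e => hiJ (e ▸ hj)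
  have hPD : ∀ j ∈ J, (P j).card ≤ D := fun j hj =>
    (Finset.card_le_card fun y hy => mem_nbrIn.2
      ⟨hBS j (hJI hj) (hPB j hy), h.adj j (hJI hj) y (hPB j hy)⟩).trans
        (hmax _ (haS j (hJI hj)))
  have hPd : ∀ j ∈ J, ∀ l ∈ J, j ≠ l → Disjoint (P j) (P l) := fun j hj l hl hjl =>
    ((h.disjoint (hJI hj) (hJI hl) hjl).mono_left (hPB j)).mono_right (hPB l)
  have htot : 2 * (2 * q * D) * q ≤ ∑ j ∈ J, (P j).card := by
    have h1 : ∀ j ∈ J, D ≤ 512 * q * (P j).card := fun j hj => by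
      have := hB j (hJI hj)
      have := hl j hj
      simp only [hP]
      nlinarith
    have h2 : J.card * D ≤ 512 * q * ∑ j ∈ J, (P j).card := by
      rw [Finset.mul_sum]
      simpa using Finset.card_nsmul_le_sum J _ D h1
    have h3 : 2048 * q ^ 3 * D ≤ J.card * D := Nat.mul_le_mul_right _ hJ
    refine le_of_mul_le_mul_left (a := 512 * q) ?_ (by positivity)
    calc 512 * q * (2 * (2 * q * D) * q) = 2048 * q ^ 3 * D := by ring
      _ ≤ _ := h3.trans h2
  -- first the indices are divided, then the neighbourhoods in `B i`; a class of the latter is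
  -- worth at most `D`, being contained in the neighbourhood of a vertex of `B i`
  obtain ⟨f, hf, hfd⟩ := exists_fair_division (2 * q * D) (by positivity)
    (fun _ j => (P j).card) (Finset.range q) J
    (fun _ _ j hj => (hPD j hj).trans (by nlinarith)) (fun _ _ => by simpa using htot)
  set U : ℕ → Finset V := fun t => (f t).biUnion P with hU
  have hUS : ∀ t ∈ Finset.range q, U t ⊆ S := fun t ht => by
    refine Finset.biUnion_subset.2 fun j hj => ?_
    have := hJI ((hf t ht).1 hj)
    exact (hPB j).trans (hBS j this)
  have hUc : ∀ t ∈ Finset.range q, 2 * q * D ≤ (U t).card := fun t ht => by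
    rw [hU, Finset.card_biUnion]
    · exact (hf t ht).2
    · exact fun j hj l hl hjl => hPd j ((hf t ht).1 hj) l ((hf t ht).1 hl) hjl
  set σ : V → Finset V := fun y => nbrIn G y (B i) with hσ
  obtain ⟨g, hg, hgd⟩ := exists_fair_division D hD
    (fun t s => ((U t).filter fun y => σ y = s).card) (Finset.range q)
    ((Finset.range q).biUnion fun t => (U t).image σ)
    (fun t ht s hs => by
      obtain ⟨t', ht', hs⟩ := Finset.mem_biUnion.1 hs
      obtain ⟨y, hy, rfl⟩ := Finset.mem_image.1 hs
      obtain ⟨j, hj, hy⟩ := Finset.mem_biUnion.1 hy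
      obtain ⟨hy1, b, hb, hby⟩ := mem_nbrOf.1 hy
      refine (Finset.card_le_card fun z hz => ?_).trans (hmax b (hBS i hi hb))
      obtain ⟨hz1, hz2⟩ := Finset.mem_filter.1 hz
      have : b ∈ σ z := by rw [hz2]; exact mem_nbrIn.2 ⟨hb, hby.symm⟩
      exact mem_nbrIn.2 ⟨hUS t ht hz1, (mem_nbrIn.1 this).2.symm⟩)
    (fun t ht => by
      rw [← Finset.card_eq_sum_card_fiberwise (f := σ) (s := U t)]
      · have := hUc t ht
        rw [Finset.card_range]
        linarith
      · intro y hy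
        exact Finset.mem_coe.2 (Finset.mem_biUnion.2 ⟨t, ht, Finset.mem_image_of_mem _ hy⟩))
  refine HasBlockade.of_finset (Finset.range q) (by simp)
    (fun t => (U t).filter fun y => σ y ∈ g t)
    (fun t ht => (Finset.filter_subset _ _).trans (hUS t ht)) (fun t ht => ?_) ?_ ?_
  · refine hSC.trans (Nat.mul_le_mul_left _ ((hg t ht).2.trans (le_of_eq ?_)))
    rw [Finset.card_eq_sum_card_fiberwise (f := σ) (t := g t)]
    · refine Finset.sum_congr rfl fun s hs => congrArg _ ?_
      ext y
      simp only [Finset.mem_filter]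
      constructor
      · rintro ⟨h1, rfl⟩; exact ⟨⟨h1, hs⟩, rfl⟩
      · rintro ⟨⟨h1, -⟩, h2⟩; exact ⟨h1, h2⟩
    · intro y hy
      exact (Finset.mem_filter.1 (Finset.mem_coe.1 hy)).2
  · intro t ht t' ht' hne
    refine Finset.disjoint_left.2 fun y hy hy' => ?_
    exact Finset.disjoint_left.1 (hgd t ht t' ht' hne) (Finset.mem_filter.1 hy).2
      (Finset.mem_filter.1 hy').2
  · intro t ht t' ht' htt y hy s hs hys
    obtain ⟨hy1, hy2⟩ := Finset.mem_filter.1 hy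
    obtain ⟨hs1, hs2⟩ := Finset.mem_filter.1 hs
    obtain ⟨j, hj, hy1⟩ := Finset.mem_biUnion.1 hy1
    obtain ⟨l, hl, hs1⟩ := Finset.mem_biUnion.1 hs1
    have hj' := (hf t ht).1 hj
    have hl' := (hf t' ht').1 hl
    have hjl : j ≠ l := by
      rintro rfl
      exact Finset.disjoint_left.1 (hfd t ht t' ht' htt) hj hl
    have : σ y = σ s := h.nbrIn_eq hG hi (hJI hj') (hJI hl') (hne j hj') (hne l hl') hjl
      (ha j hj') (ha l hl') (hPB j hy1) (hPB l hs1) hys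
    rw [this] at hy2
    exact Finset.disjoint_left.1 (hgd t ht t' ht' htt) hy2 hs2

/-- If no tooth in `J` is adjacent to `a i`, and every `B j` with `j ∈ J` has an edge to `B i`,
then the teeth in `J` are pairwise non-adjacent: a tooth adjacent to `a j` would be a hat on
the five-cycle through `v`, `a j`, `B j`, `B i`, `a i`. -/
theorem teeth_not_adj (h : IsComb G v I a B) (hG : NoHat G) {i j l : ι} (hi : i ∈ I)
    (hj : j ∈ I) (hl : l ∈ I) (hij : j ≠ i) (hil : l ≠ i) (hjl : j ≠ l)
    (aj : ¬ G.Adj (a i) (a j)) (al : ¬ G.Adj (a i) (a l))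
    (hP : (nbrOf G (B i) (B j)).Nonempty) : ¬ G.Adj (a j) (a l) := by
  intro hadj
  obtain ⟨y, hy⟩ := hP
  obtain ⟨hy, b, hb, hby⟩ := mem_nbrOf.1 hy
  exact hG v (a j) y b (a i) (a l) (h.apex_adj j hj) (h.adj j hj y hy) hby.symm
    (h.adj i hi b hb).symm (h.apex_adj i hi).symm (h.apex_not_adj j hj y hy)
    (h.apex_not_adj i hi b hb) (h.not_adj j hj i hi hij b hb) (fun e => aj e.symm)
    (fun e => h.not_adj i hi j hj hij.symm y hy e.symm) (h.apex_adj l hl).symm hadj.symm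
    (h.not_adj l hl j hj hjl.symm y hy) (h.not_adj l hl i hi hil b hb) (fun e => al e.symm)

/-- In a comb with non-adjacent teeth, a vertex `y` of `B j` is adjacent to both or to neither
of two adjacent vertices `b`, `b'` of `B i`: otherwise `b'` is a hat on the five-cycle
`a i, b, y, a j, v`, or the same with `b` and `b'` exchanged. -/
theorem adj_iff_of_adj (h : IsComb G v I a B) (hG : NoHat G) {i j : ι} (hi : i ∈ I)
    (hj : j ∈ I) (hij : i ≠ j) (ha : ¬ G.Adj (a i) (a j)) {b b' y : V} (hb : b ∈ B i)
    (hb' : b' ∈ B i) (hbb : G.Adj b b') (hy : y ∈ B j) : G.Adj b y ↔ G.Adj b' y := by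
  have key : ∀ b ∈ B i, ∀ b' ∈ B i, G.Adj b b' → G.Adj b y → G.Adj b' y := by
    intro b hb b' hb' hbb hby
    by_contra hcon
    exact hG (a i) b y (a j) v b' (h.adj i hi b hb) hby (h.adj j hj y hy).symm
      (h.apex_adj j hj).symm (h.apex_adj i hi) (h.not_adj i hi j hj hij y hy) ha
      (fun e => h.not_adj j hj i hi hij.symm b hb e.symm)
      (fun e => h.apex_not_adj i hi b hb e.symm) (fun e => h.apex_not_adj j hj y hy e.symm)
      (h.adj i hi b' hb').symm hbb.symm hcon
      (fun e => h.not_adj j hj i hi hij.symm b' hb' e.symm)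
      (fun e => h.apex_not_adj i hi b' hb' e.symm)
  exact ⟨key b hb b' hb' hbb, key b' hb' b hb hbb.symm⟩

/-- A comb with pairwise non-adjacent teeth: stars `Q i` inside the `B i` are pairwise complete
or anticomplete to each other, and no three are pairwise complete. -/
theorem hasBlockade_of_teeth_not_adj (h : IsComb G v I a B) (hG : NoHat G) {S : Finset V}
    {q C : ℕ} (hI : q * (2 * q + 1) ≤ I.card) (hBS : ∀ i ∈ I, B i ⊆ S)
    (ha : ∀ i ∈ I, ∀ j ∈ I, i ≠ j → ¬ G.Adj (a i) (a j))
    (hstar : ∀ i ∈ I, ∃ u ∈ B i, S.card ≤ q ^ C * (nbrIn G u (B i)).card) :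
    HasBlockade G S q C := by
  have : Nonempty V := ⟨v⟩
  choose! u hu hus using hstar
  set Q : ι → Finset V := fun i => insert (u i) (nbrIn G (u i) (B i)) with hQ
  have hQB : ∀ i ∈ I, Q i ⊆ B i := fun i hi =>
    Finset.insert_subset (hu i hi) (nbrIn_subset _ _ _)
  have hpure : ∀ i ∈ I, ∀ j ∈ I, i ≠ j → ∀ x ∈ Q i, ∀ y ∈ B j, (G.Adj x y ↔ G.Adj (u i) y) := by
    intro i hi j hj hij x hx y hy
    rcases Finset.mem_insert.1 hx with rfl | hx
    · rfl
    · obtain ⟨hx1, hx2⟩ := mem_nbrIn.1 hx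
      exact h.adj_iff_of_adj hG hi hj hij (ha i hi j hj hij) hx1 (hu i hi) hx2.symm hy
  have hpure' : ∀ i ∈ I, ∀ j ∈ I, i ≠ j → ∀ x ∈ Q i, ∀ y ∈ Q j,
      (G.Adj x y ↔ G.Adj (u i) (u j)) := by
    intro i hi j hj hij x hx y hy
    rw [hpure i hi j hj hij x hx y (hQB j hj hy), G.adj_comm,
      hpure j hj i hi hij.symm y hy _ (hu i hi), G.adj_comm]
  have main : ∀ J ⊆ I, q ≤ J.card → (∀ i ∈ J, ∀ j ∈ J, i ≠ j → ¬ G.Adj (u i) (u j)) →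
      HasBlockade G S q C := by
    intro J hJ hc hind
    refine HasBlockade.of_finset J hc Q (fun i hi => (hQB i (hJ hi)).trans (hBS i (hJ hi)))
      (fun i hi => (hus i (hJ hi)).trans (Nat.mul_le_mul_left _ (Finset.card_le_card
        (Finset.subset_insert _ _)))) (fun i hi j hj hij =>
          ((h.disjoint (hJ hi) (hJ hj) hij).mono_left (hQB i (hJ hi))).mono_right
            (hQB j (hJ hj))) fun i hi j hj hij x hx y hy => ?_
    rw [hpure' i (hJ hi) j (hJ hj) hij x hx y hy]
    exact hind i hi j hj hij
  by_cases hdeg : ∀ i ∈ I, (I.filter fun j => j ≠ i ∧ G.Adj (u i) (u j)).card ≤ q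
  · obtain ⟨J, hJ, hc, hind⟩ := exists_independent (fun i j => G.Adj (u i) (u j)) q q I hdeg hI
    exact main J hJ hc.ge hind
  · push Not at hdeg
    obtain ⟨i, hi, hc⟩ := hdeg
    refine main _ (Finset.filter_subset _ _) hc.le fun j hj l hl hjl hadj => ?_
    obtain ⟨hj, hji, hij⟩ := Finset.mem_filter.1 hj
    obtain ⟨hl, hli, hil⟩ := Finset.mem_filter.1 hl
    -- `u l` is a hat on the five-cycle `u i, u j, a j, v, a i`
    exact hG (u i) (u j) (a j) v (a i) (u l) hij (h.adj j hj _ (hu j hj)).symm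
      (h.apex_adj j hj).symm (h.apex_adj i hi) (h.adj i hi _ (hu i hi))
      (fun e => h.not_adj j hj i hi hji _ (hu i hi) e.symm)
      (fun e => h.apex_not_adj i hi _ (hu i hi) e.symm)
      (fun e => h.apex_not_adj j hj _ (hu j hj) e.symm)
      (fun e => h.not_adj i hi j hj hji.symm _ (hu j hj) e.symm)
      (fun e => ha j hj i hi hji e) hil.symm hadj.symm
      (fun e => h.not_adj j hj l hl hjl _ (hu l hl) e.symm)
      (fun e => h.apex_not_adj l hl _ (hu l hl) e.symm)
      (fun e => h.not_adj i hi l hl hli.symm _ (hu l hl) e.symm)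

/-- A comb with at least `q ^ 18` teeth and large sets `B i` yields a blockade. Either few pairs
`B i`, `B j` are substantially linked, and pruning an independent set of indices suffices, or one
`B i` is substantially linked to many `B j`, and these are split by whether `a j` is adjacent
to `a i`. -/
theorem hasBlockade (h : IsComb G v I a B) (hG : NoHat G) {S : Finset V} {D q M C : ℕ}
    (hD : 0 < D) (hq : 2 ≤ q) (hmax : ∀ x ∈ S, (nbrIn G x S).card ≤ D)
    (hSM : S.card ≤ q ^ M * D) (hMC : M + 9 ≤ C) (hBS : ∀ i ∈ I, B i ⊆ S)
    (haS : ∀ i ∈ I, a i ∈ S) (hB : ∀ i ∈ I, D ≤ 256 * (B i).card)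
    (hstar : ∀ Y ⊆ S, D ≤ 256 * Y.card → ∃ u ∈ Y, S.card ≤ q ^ C * (nbrIn G u Y).card)
    (hI : q ^ 18 ≤ I.card) : HasBlockade G S q C := by
  have hq3 : 8 ≤ q ^ 3 := by simpa using Nat.pow_le_pow_left hq 3
  have hIq : q * (2 * (4096 * q ^ 3) + 1) ≤ I.card := by
    refine le_trans ?_ hI
    have e1 : 2 ^ 14 ≤ q ^ 14 := Nat.pow_le_pow_left hq 14
    calc q * (2 * (4096 * q ^ 3) + 1) ≤ q * (2 ^ 14 * q ^ 3) := by gcongr; omega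
      _ = 2 ^ 14 * q ^ 4 := by ring
      _ ≤ q ^ 14 * q ^ 4 := by gcongr
      _ = q ^ 18 := by ring
  have h9 : 512 ≤ q ^ 9 := by simpa using Nat.pow_le_pow_left hq 9
  by_cases hdeg : ∀ i ∈ I, (I.filter fun j => j ≠ i ∧
      (B j).card ≤ 2 * q * (nbrOf G (B i) (B j)).card).card ≤ 4096 * q ^ 3
  · obtain ⟨J, hJ, hc, hind⟩ := exists_independent
      (fun i j => (B j).card ≤ 2 * q * (nbrOf G (B i) (B j)).card) _ q I
      (fun i hi => by convert hdeg i hi) hIq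
    refine HasBlockade.of_finset J hc.ge
      (fun j => B j \ (J.erase j).biUnion fun i => nbrOf G (B i) (B j))
      (fun j hj => Finset.sdiff_subset.trans (hBS j (hJ hj))) (fun j hj => ?_)
      (fun i hi j hj hij => ((h.disjoint (hJ hi) (hJ hj) hij).mono_left
        Finset.sdiff_subset).mono_right Finset.sdiff_subset) ?_
    · have h1 := card_le_two_mul_card_sdiff (B j) (J.erase j) (fun i => nbrOf G (B i) (B j))
        (fun i hi => by
          have h2 := hind i (Finset.mem_of_mem_erase hi) j hj (Finset.ne_of_mem_erase hi)
          have h3 : (J.erase j).card ≤ q := hc ▸ Finset.card_le_card (Finset.erase_subset _ _)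
          have h4 : 2 * (J.erase j).card * (nbrOf G (B i) (B j)).card ≤
            2 * q * (nbrOf G (B i) (B j)).card := by gcongr
          omega)
      have h2 := hB j (hJ hj)
      set X := B j \ (J.erase j).biUnion fun i => nbrOf G (B i) (B j)
      calc S.card ≤ q ^ M * D := hSM
        _ ≤ q ^ M * (q ^ 9 * X.card) := by gcongr; nlinarith
        _ = q ^ (M + 9) * X.card := by ring
        _ ≤ q ^ C * X.card := by gcongr; omega
    · intro i hi j hj hij x hx y hy hxy
      rw [Finset.mem_sdiff] at hy
      exact hy.2 (Finset.mem_biUnion.2 ⟨i, Finset.mem_erase.2 ⟨hij, hi⟩,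
        mem_nbrOf.2 ⟨hy.1, x, (Finset.mem_sdiff.1 hx).1, hxy⟩⟩)
  · push Not at hdeg
    obtain ⟨i, hi, hc⟩ := hdeg
    set L := I.filter fun j => j ≠ i ∧ (B j).card ≤ 2 * q * (nbrOf G (B i) (B j)).card
    have hL : ∀ j ∈ L, j ∈ I ∧ j ≠ i ∧ (B j).card ≤ 2 * q * (nbrOf G (B i) (B j)).card :=
      fun j hj => Finset.mem_filter.1 hj
    have hsplit := Finset.card_filter_add_card_filter_not (s := L) fun j => G.Adj (a i) (a j)
    -- one of the two classes has at least half of the more than `4096 * q ^ 3` indices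
    rcases Nat.lt_or_ge (L.filter fun j => G.Adj (a i) (a j)).card (2048 * q ^ 3) with h1 | h1
    · have h2 : 2048 * q ^ 3 ≤ (L.filter fun j => ¬ G.Adj (a i) (a j)).card := by omega
      set J := L.filter fun j => ¬ G.Adj (a i) (a j)
      have hJ : ∀ j ∈ J, j ∈ L ∧ ¬ G.Adj (a i) (a j) := fun j hj => Finset.mem_filter.1 hj
      refine (h.mono fun j hj => (hL j (hJ j hj).1).1).hasBlockade_of_teeth_not_adj hG (I := J)
        (le_trans ?_ h2) (fun j hj => hBS j (hL j (hJ j hj).1).1) ?_ ?_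
      · nlinarith [Nat.mul_le_mul_right (q ^ 2) hq, pow_pos (show 0 < q by omega) 2]
      · intro j hj l hl hjl
        obtain ⟨hj1, hj2⟩ := hJ j hj
        obtain ⟨hl1, hl2⟩ := hJ l hl
        obtain ⟨hj3, hj4, hj5⟩ := hL j hj1
        obtain ⟨hl3, hl4, hl5⟩ := hL l hl1
        refine h.teeth_not_adj hG hi hj3 hl3 hj4 hl4 hjl hj2 hl2 ?_
        rw [Finset.nonempty_iff_ne_empty]
        intro e
        rw [e] at hj5
        have := hB j hj3
        simp at hj5
        simp [hj5] at this
        omega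
      · exact fun j hj => hstar _ (hBS j (hL j (hJ j hj).1).1) (hB j (hL j (hJ j hj).1).1)
    · refine h.hasBlockade_of_adj hG hD (by omega) hmax (hSM.trans ?_) hBS haS hB hi
        (J := L.filter fun j => G.Adj (a i) (a j))
        (fun j hj => (hL j (Finset.mem_filter.1 hj).1).1)
        (fun hi' => (hL i (Finset.mem_filter.1 hi').1).2.1 rfl) h1
        (fun j hj => (Finset.mem_filter.1 hj).2)
        (fun j hj => (hL j (Finset.mem_filter.1 hj).1).2.2)
      gcongr <;> omega

end IsComb

/-! ### Second neighbourhoods in sparse sets -/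

/-- Second neighbourhoods are small: without a blockade, the neighbourhoods of all neighbours of
`w` are mostly contained in one set of size `q ^ 48 * D`. Otherwise neighbours of `w` with
largely disjoint private neighbourhoods form a comb. -/
theorem exists_small_cover {V : Type} {G : SimpleGraph V} (hG : NoHat G) {S : Finset V}
    {D q M C : ℕ} (hD : 0 < D) (hq : 2 ≤ q) (hmax : ∀ x ∈ S, (nbrIn G x S).card ≤ D)
    (hSM : S.card ≤ q ^ M * D) (hMC : M + 9 ≤ C)
    (hstar : ∀ Y ⊆ S, D ≤ 256 * Y.card → ∃ u ∈ Y, S.card ≤ q ^ C * (nbrIn G u Y).card)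
    (hno : ¬ HasBlockade G S q C) {w : V} (hw : w ∈ S) :
    ∃ Y ⊆ S, Y.card ≤ q ^ 48 * D ∧ ∀ x ∈ nbrIn G w S, 128 * (nbrIn G x S \ Y).card ≤ D := by
  by_contra! hcon
  set k := q ^ 18 with hk
  set p := k * (2 * (256 * k) + 1) with hp
  have hpq : p + 1 ≤ q ^ 48 := by
    have h1 : 1 ≤ q ^ 18 := Nat.one_le_pow _ _ (by omega)
    have h2 : 1024 ≤ q ^ 12 := le_trans (by norm_num) (Nat.pow_le_pow_left hq 12)
    have h3 : q ^ 48 = q ^ 12 * (k * k) := by rw [hk]; ring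
    rw [h3, hp]
    have h4 : 1 ≤ k := h1
    have h5 : 1 ≤ k * k := Nat.one_le_iff_ne_zero.2 (by positivity)
    have h6 : k ≤ k * k := by nlinarith
    nlinarith [Nat.mul_le_mul_right (k * k) h2]
  have grow : ∀ n ≤ p, ∃ T ⊆ nbrIn G w S, T.card = n ∧ ∃ g : V → Finset V,
      (∀ x ∈ T, g x ⊆ nbrIn G x S ∧ D < 128 * (g x).card ∧ ∀ y ∈ g x, ¬ G.Adj w y) ∧
      ∀ x ∈ T, ∀ y ∈ T, x ≠ y → Disjoint (g x) (g y) := by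
    intro n
    induction n with
    | zero => exact fun _ => ⟨∅, by simp, by simp, fun _ => ∅, by simp, by simp⟩
    | succ n ih =>
      intro hn
      obtain ⟨T, hT, hTc, g, hg, hgd⟩ := ih (by omega)
      set Y := nbrIn G w S ∪ T.biUnion fun x => nbrIn G x S with hY
      have hYS : Y ⊆ S := Finset.union_subset (nbrIn_subset _ _ _)
        (Finset.biUnion_subset.2 fun x _ => nbrIn_subset _ _ _)
      have hYc : Y.card ≤ q ^ 48 * D := by
        have h1 : (T.biUnion fun x => nbrIn G x S).card ≤ T.card * D :=
          Finset.card_biUnion_le_card_mul _ _ _ fun x hx =>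
            hmax x (nbrIn_subset _ _ _ (hT hx))
        have h2 : Y.card ≤ _ := Finset.card_union_le (nbrIn G w S) (T.biUnion fun x => nbrIn G x S)
        have h3 := hmax w hw
        calc Y.card ≤ D + T.card * D := by omega
          _ = (n + 1) * D := by rw [hTc]; ring
          _ ≤ q ^ 48 * D := by gcongr; omega
      obtain ⟨x, hx, hxD⟩ := hcon Y hYS hYc
      have hsub : ∀ y ∈ T, nbrIn G y S ⊆ Y := fun y hy z hz =>
        Finset.mem_union_right _ (Finset.mem_biUnion.2 ⟨y, hy, hz⟩)
      have hxT : x ∉ T := fun h => by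
        rw [Finset.sdiff_eq_empty_iff_subset.2 (hsub x h)] at hxD
        simp at hxD
      have hdis : ∀ y ∈ T, Disjoint (nbrIn G x S \ Y) (g y) := fun y hy =>
        Finset.sdiff_disjoint.mono_right ((hg y hy).1.trans (hsub y hy))
      refine ⟨insert x T, Finset.insert_subset hx hT, by
        rw [Finset.card_insert_of_notMem hxT, hTc], Function.update g x (nbrIn G x S \ Y),
        fun y hy => ?_, fun y hy z hz hyz => ?_⟩
      · rcases Finset.mem_insert.1 hy with rfl | hy'
        · rw [Function.update_self]
          refine ⟨Finset.sdiff_subset, hxD, fun z hz hwz => ?_⟩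
          rw [Finset.mem_sdiff] at hz
          exact hz.2 (Finset.mem_union_left _ (mem_nbrIn.2 ⟨(mem_nbrIn.1 hz.1).1, hwz⟩))
        · rw [Function.update_of_ne (by rintro rfl; exact hxT hy')]
          exact hg y hy'
      · rcases Finset.mem_insert.1 hy with rfl | hy' <;>
          rcases Finset.mem_insert.1 hz with rfl | hz'
        · exact absurd rfl hyz
        · rw [Function.update_self, Function.update_of_ne hyz.symm]
          exact hdis z hz'
        · rw [Function.update_self, Function.update_of_ne hyz]
          exact (hdis y hy').symm
        · rw [Function.update_of_ne (by rintro rfl; exact hxT hy'),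
            Function.update_of_ne (by rintro rfl; exact hxT hz')]
          exact hgd y hy' z hz' hyz
  obtain ⟨T, hT, hTc, g, hg, hgd⟩ := grow p le_rfl
  have hTS : ∀ x ∈ T, x ∈ S := fun x hx => nbrIn_subset _ _ _ (hT hx)
  have hkpos : 0 < k := by positivity
  obtain ⟨J, hJ, hJc, hind⟩ := exists_independent
    (fun x y => (g y).card ≤ 2 * k * (nbrIn G x (g y)).card) (256 * k) k T (fun x hx => by
      set L := T.filter fun y => y ≠ x ∧ (g y).card ≤ 2 * k * (nbrIn G x (g y)).card
      have hLT : L ⊆ T := Finset.filter_subset _ _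
      have h1 : (L.biUnion fun y => nbrIn G x (g y)).card ≤ D :=
        (Finset.card_le_card (Finset.biUnion_subset.2 fun y hy => nbrIn_mono G x
          ((hg y (hLT hy)).1.trans (nbrIn_subset _ _ _)))).trans (hmax x (hTS x hx))
      rw [Finset.card_biUnion fun y hy z hz hyz => ((hgd y (hLT hy) z (hLT hz) hyz).mono_left
        (nbrIn_subset _ _ _)).mono_right (nbrIn_subset _ _ _)] at h1
      have h2 : ∀ y ∈ L, D ≤ 256 * k * (nbrIn G x (g y)).card := fun y hy => by
        have h3 := (Finset.mem_filter.1 hy).2.2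
        have h4 := (hg y (hLT hy)).2.1
        nlinarith
      have h3 : L.card * D ≤ 256 * k * ∑ y ∈ L, (nbrIn G x (g y)).card := by
        rw [Finset.mul_sum]
        simpa using Finset.card_nsmul_le_sum L _ D h2
      have h4 : L.card * D ≤ 256 * k * D := h3.trans (Nat.mul_le_mul_left _ h1)
      have h5 : L.card ≤ 256 * k := le_of_mul_le_mul_right h4 hD
      convert h5) hTc.ge
  set B : V → Finset V := fun y => g y \ (J.erase y).biUnion fun x => nbrIn G x (g y) with hB
  have hBg : ∀ y, B y ⊆ g y := fun y => Finset.sdiff_subset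
  have hcomb : IsComb G w J id B := by
    refine ⟨fun x hx => (mem_nbrIn.1 (hT (hJ hx))).2, fun x hx y hy =>
      (mem_nbrIn.1 ((hg x (hJ hx)).1 (hBg x hy))).2, fun x hx y hy =>
      (hg x (hJ hx)).2.2 y (hBg x hy), fun x hx z hz hxz y hy hadj => ?_⟩
    rw [hB, Finset.mem_sdiff] at hy
    exact hy.2 (Finset.mem_biUnion.2 ⟨x, Finset.mem_erase.2 ⟨hxz, hx⟩,
      mem_nbrIn.2 ⟨hy.1, hadj⟩⟩)
  refine hno (hcomb.hasBlockade hG hD hq hmax hSM hMC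
    (fun x hx => (hBg x).trans ((hg x (hJ hx)).1.trans (nbrIn_subset _ _ _)))
    (fun x hx => hTS x (hJ hx)) (fun y hy => ?_) hstar hJc.ge)
  have h1 := card_le_two_mul_card_sdiff (g y) (J.erase y) (fun x => nbrIn G x (g y))
    (fun x hx => by
      have h2 := hind x (Finset.mem_of_mem_erase hx) y hy (Finset.ne_of_mem_erase hx)
      have h3 : (J.erase y).card ≤ k := hJc ▸ Finset.card_le_card (Finset.erase_subset _ _)
      have h4 : 2 * (J.erase y).card * (nbrIn G x (g y)).card ≤
        2 * k * (nbrIn G x (g y)).card := by gcongr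
      omega)
  have h2 := (hg y (hJ hy)).2.1
  change (g y).card ≤ 2 * (B y).card at h1
  omega

/-- Greedy choice of anticomplete sets: each set chosen excludes at most `r` vertices. -/
theorem exists_anticomplete_family {V : Type} {G : SimpleGraph V} (T : Finset V)
    (P : Finset V → Prop) (q r : ℕ) (hr : ∀ Q ⊆ T, P Q → (Q ∪ nbrOf G Q T).card ≤ r)
    (hP : ∀ X ⊆ T, T.card ≤ X.card + q * r → ∃ Q ⊆ X, P Q) :
    ∃ Q : ℕ → Finset V, (∀ i < q, Q i ⊆ T ∧ P (Q i)) ∧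
      ∀ i < q, ∀ j < q, i ≠ j →
        Disjoint (Q i) (Q j) ∧ ∀ x ∈ Q i, ∀ y ∈ Q j, ¬ G.Adj x y := by
  suffices h : ∀ n ≤ q, ∃ Q : ℕ → Finset V, (∀ i < n, Q i ⊆ T ∧ P (Q i)) ∧
      ∀ i < n, ∀ j < n, i ≠ j →
        Disjoint (Q i) (Q j) ∧ ∀ x ∈ Q i, ∀ y ∈ Q j, ¬ G.Adj x y from h q le_rfl
  intro n
  induction n with
  | zero => exact fun _ => ⟨fun _ => ∅, by simp, by simp⟩
  | succ n ih =>
    intro hn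
    obtain ⟨Q, hQ, hd⟩ := ih (by omega)
    set Z := (Finset.range n).biUnion fun i => Q i ∪ nbrOf G (Q i) T with hZ
    have hZc : Z.card ≤ n * r := by
      refine (Finset.card_biUnion_le_card_mul _ _ r fun i hi => ?_).trans (by simp)
      have := hQ i (Finset.mem_range.1 hi)
      exact hr _ this.1 this.2
    obtain ⟨Q', hQ', hPQ⟩ := hP (T \ Z) Finset.sdiff_subset (by
      have h1 := Finset.le_card_sdiff Z T
      have h2 : n * r ≤ q * r := Nat.mul_le_mul_right _ (by omega)
      omega)
    have key : ∀ i < n, Disjoint (Q i) Q' ∧ ∀ x ∈ Q i, ∀ y ∈ Q', ¬ G.Adj x y := by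
      intro i hi
      have hsub : Q i ∪ nbrOf G (Q i) T ⊆ Z := fun y hy =>
        Finset.mem_biUnion.2 ⟨i, Finset.mem_range.2 hi, hy⟩
      refine ⟨Finset.disjoint_left.2 fun y hy hy' => (Finset.mem_sdiff.1 (hQ' hy')).2
        (hsub (Finset.mem_union_left _ hy)), fun x hx y hy hxy => ?_⟩
      obtain ⟨h1, h2⟩ := Finset.mem_sdiff.1 (hQ' hy)
      exact h2 (hsub (Finset.mem_union_right _ (mem_nbrOf.2 ⟨h1, x, hx, hxy⟩)))
    refine ⟨Function.update Q n Q', fun i hi => ?_, fun i hi j hj hij => ?_⟩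
    · rcases Nat.lt_succ_iff_lt_or_eq.1 hi with hi | rfl
      · rw [Function.update_of_ne hi.ne]; exact hQ i hi
      · rw [Function.update_self]; exact ⟨hQ'.trans Finset.sdiff_subset, hPQ⟩
    · rcases Nat.lt_succ_iff_lt_or_eq.1 hi with hi | rfl <;>
        rcases Nat.lt_succ_iff_lt_or_eq.1 hj with hj | rfl
      · rw [Function.update_of_ne hi.ne, Function.update_of_ne hj.ne]; exact hd i hi j hj hij
      · rw [Function.update_of_ne hi.ne, Function.update_self]; exact key i hi
      · rw [Function.update_of_ne hj.ne, Function.update_self]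
        exact ⟨(key j hj).1.symm, fun x hx y hy h => (key j hj).2 y hy x hx h.symm⟩
      · exact absurd rfl hij

/-- If every `w ∈ S` has a small set `Y w` that captures almost all of the second neighbourhood
of `w`, then after deleting the few vertices lying in too many sets `Y w`, two vertices rarely
have a common neighbour, and neighbourhoods can be chosen greedily. -/
theorem hasBlockade_of_cover {V : Type} {G : SimpleGraph V} {S : Finset V}
    {D q M C : ℕ} (hD : 0 < D) (hq : 2 ≤ q) (hmax : ∀ x ∈ S, (nbrIn G x S).card ≤ D)
    (hSm : q ^ 108 * D ≤ S.card) (hSM : S.card ≤ q ^ M * D) (hMC : M + 9 ≤ C)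
    (hdeg : ∀ Y ⊆ S, S.card ≤ 4 * Y.card → ∃ v ∈ Y, D ≤ 32 * (nbrIn G v Y).card)
    (Y : V → Finset V) (hYS : ∀ w ∈ S, Y w ⊆ S) (hYc : ∀ w ∈ S, (Y w).card ≤ q ^ 48 * D)
    (hY : ∀ w ∈ S, ∀ x ∈ nbrIn G w S, 128 * (nbrIn G x S \ Y w).card ≤ D) :
    HasBlockade G S q C := by
  set R : V → Finset V := fun u => S.filter fun w => u ∈ Y w with hR
  set H := S.filter fun u => 4 * q ^ 48 * D ≤ (R u).card with hH
  have hHc : 4 * H.card ≤ S.card := by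
    have h1 : ∑ u ∈ S, (R u).card = ∑ w ∈ S, (Y w).card := by
      have := Finset.sum_card_bipartiteAbove_eq_sum_card_bipartiteBelow (s := S) (t := S)
        (fun u w => u ∈ Y w)
      simp only [Finset.bipartiteAbove, Finset.bipartiteBelow] at this
      rw [this]
      refine Finset.sum_congr rfl fun w hw => ?_
      congr 1
      ext u
      simp only [Finset.mem_filter]
      exact ⟨fun h => h.2, fun h => ⟨hYS w hw h, h⟩⟩
    have h2 : ∑ w ∈ S, (Y w).card ≤ S.card * (q ^ 48 * D) := by
      simpa using Finset.sum_le_card_nsmul S _ _ hYc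
    have h3 : H.card * (4 * q ^ 48 * D) ≤ ∑ u ∈ H, (R u).card := by
      simpa using Finset.card_nsmul_le_sum H _ _ fun u hu => (Finset.mem_filter.1 hu).2
    have h4 : ∑ u ∈ H, (R u).card ≤ ∑ u ∈ S, (R u).card :=
      Finset.sum_le_sum_of_subset (Finset.filter_subset _ _)
    refine le_of_mul_le_mul_right (a := q ^ 48 * D) ?_ (by positivity)
    calc 4 * H.card * (q ^ 48 * D) = H.card * (4 * q ^ 48 * D) := by ring
      _ ≤ _ := by omega
  set S₀ := S \ H with hS₀
  set A := S₀.filter fun x => 32 * (nbrIn G x S₀).card < D with hA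
  have hAc : 4 * A.card < S.card := by
    by_contra! hcon
    obtain ⟨v, hv, hvD⟩ := hdeg A ((Finset.filter_subset _ _).trans Finset.sdiff_subset) hcon
    have h1 := (Finset.mem_filter.1 hv).2
    have h2 : (nbrIn G v A).card ≤ (nbrIn G v S₀).card :=
      Finset.card_le_card (nbrIn_mono G v (Finset.filter_subset _ _))
    omega
  set T := S₀ \ A with hT
  have hTS₀ : T ⊆ S₀ := Finset.sdiff_subset
  have hS₀S : S₀ ⊆ S := Finset.sdiff_subset
  have hTS : T ⊆ S := hTS₀.trans hS₀S
  have hTc : S.card ≤ 2 * T.card := by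
    have h1 := Finset.le_card_sdiff H S
    have h2 := Finset.le_card_sdiff A S₀
    rw [← hT] at h2
    rw [← hS₀] at h1
    omega
  have hTdeg : ∀ x ∈ T, D ≤ 32 * (nbrIn G x S₀).card := fun x hx => by
    obtain ⟨h1, h2⟩ := Finset.mem_sdiff.1 hx
    by_contra! hcon
    exact h2 (Finset.mem_filter.2 ⟨h1, hcon⟩)
  -- a common neighbour `x ∈ T` of `z` and `w` has most of its neighbours in `Y z ∩ Y w`
  have hcommon : ∀ z ∈ S, (S.filter fun w => ∃ x ∈ T, G.Adj z x ∧ G.Adj w x).card ≤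
      256 * q ^ 96 * D := by
    intro z hz
    set W := S.filter fun w => ∃ x ∈ T, G.Adj z x ∧ G.Adj w x
    have hWS : W ⊆ S := Finset.filter_subset _ _
    have h1 : ∀ w ∈ W, D ≤ 64 * ((Y z ∩ S₀).filter fun u => u ∈ Y w).card := by
      intro w hw
      obtain ⟨hw, x, hx, hzx, hwx⟩ := Finset.mem_filter.1 hw
      have a1 := hY z hz x (mem_nbrIn.2 ⟨hTS hx, hzx⟩)
      have a2 := hY w hw x (mem_nbrIn.2 ⟨hTS hx, hwx⟩)
      have a3 := hTdeg x hx
      have a4 : nbrIn G x S₀ ⊆ ((Y z ∩ S₀).filter fun u => u ∈ Y w) ∪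
          ((nbrIn G x S \ Y z) ∪ (nbrIn G x S \ Y w)) := by
        intro u hu
        have hu' := nbrIn_mono G x hS₀S hu
        have hu₀ := nbrIn_subset _ _ _ hu
        simp only [Finset.mem_union, Finset.mem_filter, Finset.mem_inter, Finset.mem_sdiff]
        tauto
      have a5 := (Finset.card_le_card a4).trans (Finset.card_union_le _ _)
      have a6 := Finset.card_union_le (nbrIn G x S \ Y z) (nbrIn G x S \ Y w)
      omega
    have h2 : W.card * D ≤ 64 * ∑ w ∈ W, ((Y z ∩ S₀).filter fun u => u ∈ Y w).card := by
      rw [Finset.mul_sum]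
      simpa using Finset.card_nsmul_le_sum W _ D h1
    have h3 : ∑ w ∈ W, ((Y z ∩ S₀).filter fun u => u ∈ Y w).card =
        ∑ u ∈ Y z ∩ S₀, (W.filter fun w => u ∈ Y w).card := by
      have := Finset.sum_card_bipartiteAbove_eq_sum_card_bipartiteBelow (s := W)
        (t := Y z ∩ S₀) (fun w u => u ∈ Y w)
      simpa only [Finset.bipartiteAbove, Finset.bipartiteBelow] using this
    have h4 : ∑ u ∈ Y z ∩ S₀, (W.filter fun w => u ∈ Y w).card ≤
        (Y z ∩ S₀).card * (4 * q ^ 48 * D) := by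
      rw [← smul_eq_mul]
      refine Finset.sum_le_card_nsmul (Y z ∩ S₀) _ (4 * q ^ 48 * D) fun u hu => ?_
      obtain ⟨-, hu⟩ := Finset.mem_inter.1 hu
      obtain ⟨hu1, hu2⟩ := Finset.mem_sdiff.1 hu
      refine (Finset.card_le_card (Finset.filter_subset_filter _ hWS)).trans ?_
      by_contra! hcon
      exact hu2 (Finset.mem_filter.2 ⟨hu1, hcon.le⟩)
    have h5 : (Y z ∩ S₀).card ≤ q ^ 48 * D :=
      (Finset.card_le_card Finset.inter_subset_left).trans (hYc z hz)
    refine le_of_mul_le_mul_right (a := D) ?_ hD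
    calc W.card * D ≤ 64 * ((Y z ∩ S₀).card * (4 * q ^ 48 * D)) := by omega
      _ ≤ 64 * (q ^ 48 * D * (4 * q ^ 48 * D)) := by gcongr
      _ = 256 * q ^ 96 * D * D := by ring
  obtain ⟨Q, hQ, hQd⟩ := exists_anticomplete_family (G := G) T
    (fun Q => ∃ z ∈ S, (∀ x ∈ Q, G.Adj z x) ∧ D ≤ 32 * Q.card) q (q ^ 105 * D)
    (fun Q hQT ⟨z, hz, hzQ, _⟩ => by
      have h1 : Q.card ≤ D := (Finset.card_le_card fun x hx =>
        mem_nbrIn.2 ⟨hTS (hQT hx), hzQ x hx⟩).trans (hmax z hz)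
      have h2 : (nbrOf G Q T).card ≤ 256 * q ^ 96 * D :=
        (Finset.card_le_card fun w hw => by
          obtain ⟨hw, x, hx, hxw⟩ := mem_nbrOf.1 hw
          exact Finset.mem_filter.2 ⟨hTS hw, x, hQT hx, hzQ x hx, hxw.symm⟩).trans (hcommon z hz)
      have h3 : 257 ≤ q ^ 9 := le_trans (by norm_num) (Nat.pow_le_pow_left hq 9)
      have h4 : 1 ≤ q ^ 96 := Nat.one_le_pow _ _ (by omega)
      calc (Q ∪ nbrOf G Q T).card ≤ 1 * D + 256 * q ^ 96 * D := by
            have := Finset.card_union_le Q (nbrOf G Q T)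
            omega
        _ ≤ q ^ 96 * D + 256 * q ^ 96 * D := by gcongr
        _ = 257 * (q ^ 96 * D) := by ring
        _ ≤ q ^ 9 * (q ^ 96 * D) := by gcongr
        _ = q ^ 105 * D := by ring)
    (fun X hX hc => by
      have h1 : 4 * (q * (q ^ 105 * D)) ≤ S.card := by
        have h2 : 4 ≤ q ^ 2 := Nat.pow_le_pow_left hq 2
        calc 4 * (q * (q ^ 105 * D)) = 4 * (q ^ 106 * D) := by ring
          _ ≤ q ^ 2 * (q ^ 106 * D) := by gcongr
          _ = q ^ 108 * D := by ring
          _ ≤ S.card := hSm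
      obtain ⟨v, hv, hvD⟩ := hdeg X (hX.trans hTS) (by omega)
      exact ⟨nbrIn G v X, nbrIn_subset _ _ _, v, hTS (hX hv),
        fun x hx => (mem_nbrIn.1 hx).2, hvD⟩)
  refine HasBlockade.of_finset (Finset.range q) (by simp) Q
    (fun i hi => (hQ i (Finset.mem_range.1 hi)).1.trans hTS) (fun i hi => ?_)
    (fun i hi j hj hij => (hQd i (Finset.mem_range.1 hi) j (Finset.mem_range.1 hj) hij).1)
    (fun i hi j hj hij => (hQd i (Finset.mem_range.1 hi) j (Finset.mem_range.1 hj) hij).2)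
  obtain ⟨-, z, -, -, h1⟩ := hQ i (Finset.mem_range.1 hi)
  have h2 : 32 ≤ q ^ 9 := le_trans (by norm_num) (Nat.pow_le_pow_left hq 9)
  calc S.card ≤ q ^ M * D := hSM
    _ ≤ q ^ M * (q ^ 9 * (Q i).card) := by gcongr; nlinarith
    _ = q ^ (M + 9) * (Q i).card := by ring
    _ ≤ q ^ C * (Q i).card := by gcongr; omega

/-! ### An extremal sparse set -/

/-- A sparse set has a blockade if its linear-size subsets `Y` contain vertices of degree about
`D` in `Y`, and its subsets of size about `D` contain vertices of degree at least
`|S| / q ^ C`. -/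
theorem hasBlockade_of_sparse {V : Type} {G : SimpleGraph V} (hG : NoHat G) {S : Finset V}
    {D q M C : ℕ} (hD : 0 < D) (hq : 2 ≤ q) (hmax : ∀ x ∈ S, (nbrIn G x S).card ≤ D)
    (hSm : q ^ 108 * D ≤ S.card) (hSM : S.card ≤ q ^ M * D) (hMC : M + 9 ≤ C)
    (hdeg : ∀ Y ⊆ S, S.card ≤ 4 * Y.card → ∃ v ∈ Y, D ≤ 32 * (nbrIn G v Y).card)
    (hstar : ∀ Y ⊆ S, D ≤ 256 * Y.card → ∃ u ∈ Y, S.card ≤ q ^ C * (nbrIn G u Y).card) :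
    HasBlockade G S q C := by
  by_contra hno
  choose! Y hYS hYc hY using fun w (hw : w ∈ S) =>
    exists_small_cover hG hD hq hmax hSM hMC hstar hno hw
  exact hno (hasBlockade_of_cover hD hq hmax hSm hSM hMC hdeg Y hYS hYc hY)

/-- One more than the maximum degree of the subgraph induced on `X`. -/
noncomputable def degBound {V : Type} (G : SimpleGraph V) (X : Finset V) : ℕ :=
  (X.sup fun v => (nbrIn G v X).card) + 1

theorem card_nbrIn_lt_degBound {V : Type} (G : SimpleGraph V) {X : Finset V} {v : V}
    (hv : v ∈ X) : (nbrIn G v X).card < degBound G X :=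
  Nat.lt_succ_of_le (Finset.le_sup (f := fun v => (nbrIn G v X).card) hv)

theorem exists_degBound_eq {V : Type} (G : SimpleGraph V) {X : Finset V} (hX : X.Nonempty) :
    ∃ v ∈ X, degBound G X = (nbrIn G v X).card + 1 := by
  obtain ⟨v, hv, h⟩ := Finset.exists_mem_eq_sup X hX fun v => (nbrIn G v X).card
  exact ⟨v, hv, by rw [degBound, h]⟩

/-- A sparse set `X₀` contains a set `S` maximizing `|S| ^ 2 / degBound S` among sufficiently
sparse sets. All large subsets of `S` then contain vertices of large degree, which gives a
blockade in `S`; if `S` has at most a fixed power of `q` vertices, single vertices form one.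
Moreover `S` is not much smaller than `X₀`. -/
theorem exists_hasBlockade_of_sparse {V : Type} {G : SimpleGraph V} (hG : NoHat G)
    (X₀ : Finset V) (hX₀ : 2 ^ 108 * degBound G X₀ ≤ X₀.card) :
    ∃ q, 2 ≤ q ∧ ∃ S ⊆ X₀, X₀.card ≤ q ^ 216 * S.card ∧ HasBlockade G S q 665 := by
  obtain ⟨m, hm⟩ : ∃ m, m = 108 := ⟨_, rfl⟩
  rw [← hm] at hX₀
  obtain ⟨S, hS, hSmax⟩ := Finset.exists_max_image
    (X₀.powerset.filter fun X => 2 ^ m * degBound G X ≤ X.card)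
    (fun X => (X.card : ℚ) ^ 2 / degBound G X) ⟨X₀, by simpa using hX₀⟩
  have hpos : ∀ X, 0 < degBound G X := fun X => Nat.succ_pos _
  have hSmax' : ∀ X ⊆ X₀, 2 ^ m * degBound G X ≤ X.card →
      X.card ^ 2 * degBound G S ≤ S.card ^ 2 * degBound G X := by
    intro X hX hc
    have h := hSmax X (Finset.mem_filter.2 ⟨Finset.mem_powerset.2 hX, hc⟩)
    have h1 : (0 : ℚ) < degBound G X := by exact_mod_cast hpos X
    have h2 : (0 : ℚ) < degBound G S := by exact_mod_cast hpos S
    rw [div_le_div_iff₀ h1 h2] at h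
    exact_mod_cast h
  rw [Finset.mem_filter, Finset.mem_powerset] at hS
  obtain ⟨hSX, hSD⟩ := hS
  set D := degBound G S with hDdef
  have hD : 0 < D := hpos S
  set N := S.card with hN
  -- `q` is the integer part of the `m`-th root of `N / D`
  obtain ⟨q, hq2, hqN, hNq⟩ : ∃ q, 2 ≤ q ∧ q ^ m * D ≤ N ∧ N < (q + 1) ^ m * D := by
    have hex : ∃ r, N < r ^ m * D := ⟨N + 1, by
      have : N + 1 ≤ (N + 1) ^ m := Nat.le_self_pow (by omega) _
      nlinarith⟩
    have h1 := Nat.find_spec hex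
    have h2 : ∀ r ≤ 2, ¬ N < r ^ m * D := fun r hr h =>
      absurd (h.trans_le ((Nat.mul_le_mul_right D (Nat.pow_le_pow_left hr m)).trans hSD))
        (lt_irrefl _)
    have h3 : 2 < Nat.find hex := by
      by_contra! hcon
      exact h2 _ hcon h1
    refine ⟨Nat.find hex - 1, by omega, ?_, ?_⟩
    · exact not_lt.1 (Nat.find_min hex (by omega))
    · rwa [Nat.sub_add_cancel (by omega)]
  have hNq2 : N ≤ q ^ (2 * m) * D := by
    refine hNq.le.trans (Nat.mul_le_mul_right _ ?_)
    rw [pow_mul]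
    exact Nat.pow_le_pow_left (by nlinarith) m
  have h2q : ∀ i, 2 ^ i ≤ q ^ i := fun i => Nat.pow_le_pow_left hq2 i
  have hNpos : 0 < N := lt_of_lt_of_le (by positivity) hqN
  refine ⟨q, hq2, S, hSX, ?_, ?_⟩
  · have h1 := hSmax' X₀ subset_rfl hX₀
    have h2 : degBound G X₀ ≤ X₀.card := le_trans (Nat.le_mul_of_pos_left _ (by positivity)) hX₀
    have h4 : 0 < X₀.card := lt_of_lt_of_le (hpos X₀) h2
    have h3 : X₀.card * D ≤ N ^ 2 := by
      refine le_of_mul_le_mul_left (a := X₀.card) ?_ h4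
      calc X₀.card * (X₀.card * D) = X₀.card ^ 2 * D := by ring
        _ ≤ N ^ 2 * degBound G X₀ := h1
        _ ≤ N ^ 2 * X₀.card := by gcongr
        _ = _ := by ring
    refine le_of_mul_le_mul_right (a := D) ?_ hD
    calc X₀.card * D ≤ N * N := by rw [← sq]; exact h3
      _ ≤ N * (q ^ (2 * m) * D) := by gcongr
      _ = q ^ 216 * N * D := by rw [hm]; ring
  rcases Nat.lt_or_ge (q ^ (6 * m + 16)) N with hbig | hsmall
  · have hDbig : q ^ (4 * m + 16) < D := by
      refine lt_of_mul_lt_mul_left (a := q ^ (2 * m)) ?_ (by positivity)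
      calc q ^ (2 * m) * q ^ (4 * m + 16) = q ^ (6 * m + 16) := by ring
        _ < N := hbig
        _ ≤ _ := hNq2
    have hD32 : 32 ≤ D := by
      have : 32 ≤ q ^ (4 * m + 16) := calc
        32 ≤ q ^ 16 := le_trans (by norm_num) (h2q 16)
        _ ≤ _ := Nat.pow_le_pow_right (by omega) (by omega)
      omega
    -- a set `Y` that is not sparse enough to compete with `S` has large degree in any case
    have halt : ∀ Y ⊆ S, Y.card < 2 ^ m * degBound G Y ∨ Y.card ^ 2 * D ≤ N ^ 2 * degBound G Y :=
      fun Y hY => by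
        rcases Nat.lt_or_ge Y.card (2 ^ m * degBound G Y) with h | h
        · exact Or.inl h
        · exact Or.inr (hSmax' Y (hY.trans hSX) h)
    refine hasBlockade_of_sparse (D := D) (M := 2 * m) hG hD hq2
      (fun x hx => (card_nbrIn_lt_degBound G hx).le) (by rw [← hm]; exact hqN) hNq2 (by omega)
      ?_ ?_
    · intro Y hY hYc
      have hYn : Y.Nonempty := Finset.card_pos.1 (by omega)
      obtain ⟨v, hv, hvd⟩ := exists_degBound_eq G hYn
      refine ⟨v, hv, ?_⟩
      have hle : D ≤ 16 * degBound G Y := by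
        rcases halt Y hY with h | h
        · refine le_of_mul_le_mul_left (a := 2 ^ m) ?_ (by positivity)
          calc 2 ^ m * D ≤ q ^ m * D := Nat.mul_le_mul_right _ (h2q m)
            _ ≤ 4 * Y.card := hqN.trans hYc
            _ ≤ 16 * (2 ^ m * degBound G Y) := by omega
            _ = _ := by ring
        · refine le_of_mul_le_mul_left (a := N ^ 2) ?_ (by positivity)
          calc N ^ 2 * D ≤ (4 * Y.card) ^ 2 * D := by gcongr
            _ = 16 * (Y.card ^ 2 * D) := by ring
            _ ≤ 16 * (N ^ 2 * degBound G Y) := by gcongr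
            _ = _ := by ring
      omega
    · intro Y hY hYc
      have hYn : Y.Nonempty := Finset.card_pos.1 (by omega)
      obtain ⟨v, hv, hvd⟩ := exists_degBound_eq G hYn
      refine ⟨v, hv, ?_⟩
      have hle : N ≤ q ^ (6 * m + 16) * degBound G Y := by
        rcases halt Y hY with h | h
        · calc N ≤ q ^ (2 * m) * D := hNq2
            _ ≤ q ^ (2 * m) * (2 ^ 8 * (2 ^ m * degBound G Y)) := by gcongr; omega
            _ ≤ q ^ (2 * m) * (q ^ 8 * (q ^ m * degBound G Y)) := by gcongr
            _ = q ^ (3 * m + 8) * degBound G Y := by ring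
            _ ≤ _ := by gcongr <;> omega
        · refine le_of_mul_le_mul_left (a := N ^ 2) ?_ (by positivity)
          calc N ^ 2 * N = N ^ 3 := by ring
            _ ≤ (q ^ (2 * m) * D) ^ 3 := by gcongr
            _ = q ^ (6 * m) * (D ^ 2 * D) := by ring
            _ ≤ q ^ (6 * m) * ((256 * Y.card) ^ 2 * D) := by gcongr
            _ = q ^ (6 * m) * (2 ^ 16 * (Y.card ^ 2 * D)) := by ring
            _ ≤ q ^ (6 * m) * (q ^ 16 * (N ^ 2 * degBound G Y)) := by gcongr
            _ = N ^ 2 * (q ^ (6 * m + 16) * degBound G Y) := by ring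
      have hv1 : 1 ≤ (nbrIn G v Y).card := by
        by_contra! hcon
        have : degBound G Y = 1 := by omega
        rw [this] at hle
        omega
      calc N ≤ q ^ (6 * m + 16) * degBound G Y := hle
        _ ≤ q ^ (6 * m + 16) * (q * (nbrIn G v Y).card) := by gcongr; nlinarith
        _ = q ^ (6 * m + 17) * (nbrIn G v Y).card := by ring
        _ = q ^ 665 * (nbrIn G v Y).card := by rw [show 6 * m + 17 = 665 by omega]
  · obtain ⟨J, hJ, hJc, hind⟩ := exists_independent (fun x y => G.Adj x y) D q S
      (fun x hx => by
        refine le_trans (Finset.card_le_card fun y hy => ?_) (card_nbrIn_lt_degBound G hx).le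
        obtain ⟨h1, -, h2⟩ := Finset.mem_filter.1 hy
        exact mem_nbrIn.2 ⟨h1, h2⟩) (by
        refine le_trans ?_ hqN
        have h1 : 4 ≤ q ^ 2 := h2q 2
        calc q * (2 * D + 1) ≤ q * (4 * D) := by gcongr; omega
          _ ≤ q * (q ^ 2 * D) := by gcongr
          _ = q ^ 3 * D := by ring
          _ ≤ q ^ m * D := by gcongr <;> omega)
    refine HasBlockade.of_finset J hJc.ge (fun x => {x})
      (fun x hx => Finset.singleton_subset_iff.2 (hJ hx)) (fun x _ => ?_)
      (fun x _ y _ hxy => Finset.disjoint_singleton.2 hxy) ?_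
    · rw [Finset.card_singleton, mul_one]
      exact hsmall.trans (pow_le_pow_right₀ (show 1 ≤ q by omega)
        (show 6 * m + 16 ≤ 665 by omega))
    · intro x hx y hy hxy x' hx' y' hy'
      rw [Finset.mem_singleton.1 hx', Finset.mem_singleton.1 hy']
      exact hind x hx y hy hxy

/-! ### Rödl's theorem -/

/-- Embedding `k` vertices with prescribed adjacencies `R i j` for `i < j`, one in each `W i`,
either succeeds or is obstructed by a set `A` whose vertices are all sparse, or all
cosparse, to a large set `B`. -/
theorem exists_embedding_or_sparse_pair {V : Type} [Nonempty V] {G : SimpleGraph V} {S : Finset V}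
    (R : ℕ → ℕ → Prop) {c t : ℕ} (hc : 0 < c) (ht : 0 < t) (k : ℕ) :
    ∀ W : ℕ → Finset V, (∀ i < k, W i ⊆ S ∧ c ^ k * t ≤ (W i).card) →
      (∃ v : ℕ → V, (∀ i < k, v i ∈ W i) ∧
        ∀ j < k, ∀ i < j, (G.Adj (v i) (v j) ↔ R i j)) ∨
      ∃ A ⊆ S, ∃ B ⊆ S, t ≤ k * A.card ∧ t ≤ B.card ∧ ∃ H : SimpleGraph V, (H = G ∨ H = Gᶜ) ∧
        ∀ a ∈ A, c * (nbrIn H a B).card ≤ B.card := by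
  induction k with
  | zero =>
    exact fun W _ => Or.inl ⟨fun _ => Classical.arbitrary V, by simp, by simp⟩
  | succ k ih =>
    intro W hW
    have hWk := hW k (by omega)
    have hct : ∀ i, t ≤ c ^ i * t := fun i => Nat.le_mul_of_pos_left _ (by positivity)
    set W' : V → ℕ → Finset V := fun v i => (W i).filter fun x => G.Adj x v ↔ R i k with hW'
    by_cases hgood : ∃ v ∈ W k, ∀ i < k, (W i).card ≤ c * (W' v i).card
    · obtain ⟨v, hv, hgood⟩ := hgood
      rcases ih (W' v) (fun i hi => ⟨(Finset.filter_subset _ _).trans (hW i (by omega)).1, by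
        refine le_of_mul_le_mul_left (a := c) ?_ hc
        calc c * (c ^ k * t) = c ^ (k + 1) * t := by ring
          _ ≤ (W i).card := (hW i (by omega)).2
          _ ≤ _ := hgood i hi⟩) with ⟨u, hu, huR⟩ | ⟨A, hA, B, hB, h1, h2, h3⟩
      · refine Or.inl ⟨Function.update u k v, fun i hi => ?_, fun j hj i hij => ?_⟩
        · rcases Nat.lt_succ_iff_lt_or_eq.1 hi with hi | rfl
          · rw [Function.update_of_ne hi.ne]
            exact (Finset.mem_filter.1 (hu i hi)).1
          · rwa [Function.update_self]
        · rcases Nat.lt_succ_iff_lt_or_eq.1 hj with hj | rfl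
          · rw [Function.update_of_ne hj.ne, Function.update_of_ne (hij.trans hj).ne]
            exact huR j hj i hij
          · rw [Function.update_self, Function.update_of_ne hij.ne]
            exact (Finset.mem_filter.1 (hu i hij)).2
      · exact Or.inr ⟨A, hA, B, hB, h1.trans (Nat.mul_le_mul_right _ (by omega)), h2, h3⟩
    · push Not at hgood
      set A : ℕ → Finset V := fun i => (W k).filter fun v => c * (W' v i).card < (W i).card
      have hcov : W k ⊆ (Finset.range k).biUnion A := fun v hv => by
        obtain ⟨i, hi, h⟩ := hgood v hv
        exact Finset.mem_biUnion.2 ⟨i, Finset.mem_range.2 hi, Finset.mem_filter.2 ⟨hv, h⟩⟩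
      have hsum : t ≤ ∑ i ∈ Finset.range k, (A i).card :=
        ((hct _).trans hWk.2).trans ((Finset.card_le_card hcov).trans Finset.card_biUnion_le)
      have hk : (Finset.range k).Nonempty := by
        rw [Finset.nonempty_iff_ne_empty]
        intro h
        rw [h] at hsum
        simp at hsum
        omega
      obtain ⟨i, hi, hmax⟩ := Finset.exists_max_image (Finset.range k) (fun i => (A i).card) hk
      have hi' := Finset.mem_range.1 hi
      refine Or.inr ⟨A i, (Finset.filter_subset _ _).trans hWk.1, W i, (hW i (by omega)).1, ?_,
        (hct _).trans (hW i (by omega)).2, if R i k then G else Gᶜ, by split_ifs <;> simp,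
        fun a ha => ?_⟩
      · have : ∑ i ∈ Finset.range k, (A i).card ≤ k * (A i).card := by
          simpa using Finset.sum_le_card_nsmul (Finset.range k) _ _ hmax
        nlinarith
      · refine le_trans (Nat.mul_le_mul_left _ (Finset.card_le_card fun x hx => ?_))
          (Finset.mem_filter.1 ha).2.le
        obtain ⟨hx1, hx2⟩ := mem_nbrIn.1 hx
        refine Finset.mem_filter.2 ⟨hx1, ?_⟩
        split_ifs at hx2 with hR
        · simp [hR, hx2.symm]
        · rw [SimpleGraph.compl_adj, G.adj_comm] at hx2
          simp [hR, hx2.2]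

/-- In a graph without a hatted five-cycle, any `S` contains disjoint sets `A` and `B` of linear
size with the vertices of `A` all sparse, or all cosparse, to `B`. -/
theorem exists_disjoint_sparse_pair {V : Type} {G : SimpleGraph V} (hG : NoHat G)
    {S : Finset V} {c s : ℕ} (hc : 0 < c) (hs : 0 < s) (hS : c ^ 6 * (12 * s) ≤ S.card) :
    ∃ A ⊆ S, ∃ B ⊆ S, Disjoint A B ∧ A.card = s ∧ s ≤ B.card ∧
      ∃ H : SimpleGraph V, (H = G ∨ H = Gᶜ) ∧ ∀ a ∈ A, c * (nbrIn H a B).card ≤ 2 * B.card := by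
  have : Nonempty V := by
    obtain ⟨x, -⟩ := Finset.card_pos.1 (lt_of_lt_of_le (by positivity) hS)
    exact ⟨x⟩
  -- the pattern of a five-cycle `0, 1, 2, 3, 4` with a hat `5` on the edge `01`
  rcases exists_embedding_or_sparse_pair (G := G) (S := S)
    (fun i j => (i, j) ∈ ([(0, 1), (1, 2), (2, 3), (3, 4), (0, 4), (0, 5), (1, 5)] : List (ℕ × ℕ)))
    hc (show 0 < 12 * s by omega) 6 (fun _ => S) (fun _ _ => ⟨subset_rfl, hS⟩)
    with ⟨v, -, hv⟩ | ⟨A, hA, B, hB, h1, h2, H, hH, h3⟩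
  · exfalso
    have h := fun i j (hj : j < 6) (hi : i < j) => hv j hj i hi
    refine hG (v 0) (v 1) (v 2) (v 3) (v 4) (v 5) ?_ ?_ ?_ ?_ ?_ ?_ ?_ ?_ ?_ ?_ ?_ ?_ ?_ ?_ ?_
    · simp [h 0 1]
    · simp [h 1 2]
    · simp [h 2 3]
    · simp [h 3 4]
    · rw [G.adj_comm]; simp [h 0 4]
    · simp [h 0 2]
    · simp [h 0 3]
    · simp [h 1 3]
    · simp [h 1 4]
    · simp [h 2 4]
    · rw [G.adj_comm]; simp [h 0 5]
    · rw [G.adj_comm]; simp [h 1 5]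
    · rw [G.adj_comm]; simp [h 2 5]
    · rw [G.adj_comm]; simp [h 3 5]
    · rw [G.adj_comm]; simp [h 4 5]
  · obtain ⟨A', hA', hA'c⟩ := Finset.exists_subset_card_eq (s := A) (n := s) (by omega)
    have h4 := Finset.le_card_sdiff A' B
    refine ⟨A', hA'.trans hA, B \ A', Finset.sdiff_subset.trans hB, Finset.disjoint_sdiff, hA'c,
      by omega, H, hH, fun a ha => ?_⟩
    have h5 : c * (nbrIn H a (B \ A')).card ≤ c * (nbrIn H a B).card :=
      Nat.mul_le_mul_left _ (Finset.card_le_card (nbrIn_mono H a Finset.sdiff_subset))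
    have h6 := h3 a (hA' ha)
    omega

/-- Iterating `exists_disjoint_sparse_pair` inside the set `A` gives a sequence of disjoint sets
such that the vertices of later sets are sparse to each earlier set, in `G` or in its
complement. -/
theorem exists_sparse_chain {V : Type} {G : SimpleGraph V} (hG : NoHat G) {c : ℕ} (hc : 0 < c)
    (n : ℕ) : ∀ S : Finset V, (24 * c ^ 6) ^ n ≤ S.card →
      ∃ (B : ℕ → Finset V) (H : ℕ → SimpleGraph V),
        (∀ i < n, B i ⊆ S ∧ S.card ≤ (24 * c ^ 6) ^ n * (B i).card ∧ (H i = G ∨ H i = Gᶜ)) ∧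
        ∀ j < n, ∀ i < j, Disjoint (B i) (B j) ∧
          ∀ x ∈ B j, c * (nbrIn (H i) x (B i)).card ≤ 2 * (B i).card := by
  induction n with
  | zero => exact fun S _ => ⟨fun _ => ∅, fun _ => G, by simp, by simp⟩
  | succ n ih =>
    intro S hS
    have hc6 : 0 < c ^ 6 := by positivity
    set M := 24 * c ^ 6 with hM
    have hM0 : 0 < M := by positivity
    have hMn : 1 ≤ M ^ n := Nat.one_le_pow _ _ hM0
    have hMS : M ≤ S.card := le_trans (by rw [pow_succ]; nlinarith) hS
    set s := S.card / (12 * c ^ 6) with hs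
    have hs1 : 12 * c ^ 6 * s ≤ S.card := Nat.mul_div_le _ _
    have hs2 : S.card < 12 * c ^ 6 * (s + 1) := Nat.lt_mul_div_succ _ (by positivity)
    have hs0 : 0 < s := Nat.div_pos (by omega) (by positivity)
    have hs3 : S.card ≤ M * s := by nlinarith
    obtain ⟨A, hA, B₀, hB₀, hd, hAs, hBs, H₀, hH₀, hsp⟩ :=
      exists_disjoint_sparse_pair hG (S := S) hc hs0 (by linarith)
    obtain ⟨B, H, h1, h2⟩ := ih A (by
      refine le_of_mul_le_mul_left (a := M) ?_ hM0
      rw [hAs]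
      exact (le_of_eq (by ring)).trans (hS.trans hs3))
    refine ⟨fun i => Nat.casesOn i B₀ B, fun i => Nat.casesOn i H₀ H, fun i hi => ?_,
      fun j hj i hij => ?_⟩
    · cases i with
      | zero =>
        refine ⟨hB₀, ?_, hH₀⟩
        calc S.card ≤ M * s := hs3
          _ ≤ M * B₀.card := by gcongr
          _ = 1 * M * B₀.card := by ring
          _ ≤ M ^ n * M * B₀.card := by gcongr
      | succ i =>
        obtain ⟨a1, a2, a3⟩ := h1 i (by omega)
        refine ⟨a1.trans hA, ?_, a3⟩
        calc S.card ≤ M * s := hs3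
          _ ≤ M * (M ^ n * (B i).card) := by gcongr; omega
          _ = _ := by ring
    · cases j with
      | zero => omega
      | succ j =>
        have hj' := (h1 j (by omega)).1
        cases i with
        | zero => exact ⟨(hd.mono_left hj').symm, fun x hx => hsp x (hj' hx)⟩
        | succ i => exact h2 j (by omega) i (by omega)

/-- Equally large subsets of the members of a sparse chain can be chosen, from the last to the
first, so that their union `U` spans few edges: mostly those inside the members. -/
theorem exists_union_few_edges {V : Type} (H : SimpleGraph V) (B : ℕ → Finset V) (c b : ℕ)
    (I : Finset ℕ) : (∀ i ∈ I, 2 * b ≤ (B i).card) →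
      (∀ j ∈ I, ∀ i ∈ I, i < j → Disjoint (B i) (B j) ∧
        ∀ x ∈ B j, c * (nbrIn H x (B i)).card ≤ 2 * (B i).card) →
      ∃ U ⊆ I.biUnion B, U.card = I.card * b ∧
        c * ∑ x ∈ U, (nbrIn H x U).card ≤ c * I.card * b ^ 2 + 8 * I.card ^ 2 * b ^ 2 := by
  induction I using Finset.induction_on_min with
  | empty => exact fun _ _ => ⟨∅, by simp⟩
  | insert a s ha ih =>
    intro hb hB
    obtain ⟨U, hU, hUc, hUe⟩ := ih (fun i hi => hb i (Finset.mem_insert_of_mem hi))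
      (fun j hj i hi => hB j (Finset.mem_insert_of_mem hj) i (Finset.mem_insert_of_mem hi))
    have has : a ∉ s := fun h => lt_irrefl _ (ha a h)
    have hUa : ∀ x ∈ U, x ∉ B a ∧ c * (nbrIn H x (B a)).card ≤ 2 * (B a).card := fun x hx => by
      obtain ⟨j, hj, hxj⟩ := Finset.mem_biUnion.1 (hU hx)
      have h := hB j (Finset.mem_insert_of_mem hj) a (Finset.mem_insert_self _ _) (ha j hj)
      exact ⟨fun h' => Finset.disjoint_left.1 h.1 h' hxj, h.2 x hxj⟩
    set Z := (B a).filter fun y => 4 * U.card < c * (nbrIn H y U).card with hZ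
    have hZc : 2 * Z.card ≤ (B a).card := by
      have h1 : Z.card * (4 * U.card + 1) ≤ ∑ y ∈ Z, c * (nbrIn H y U).card := by
        simpa using Finset.card_nsmul_le_sum Z _ (4 * U.card + 1) fun y hy =>
          (Finset.mem_filter.1 hy).2
      have h2 : ∑ y ∈ Z, c * (nbrIn H y U).card ≤ ∑ y ∈ B a, c * (nbrIn H y U).card :=
        Finset.sum_le_sum_of_subset (Finset.filter_subset _ _)
      have h3 : ∑ y ∈ B a, c * (nbrIn H y U).card = ∑ x ∈ U, c * (nbrIn H x (B a)).card := by
        rw [← Finset.mul_sum, ← Finset.mul_sum, sum_card_nbrIn_comm]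
      have h4 : ∑ x ∈ U, c * (nbrIn H x (B a)).card ≤ U.card * (2 * (B a).card) := by
        simpa using Finset.sum_le_card_nsmul U _ _ fun x hx => (hUa x hx).2
      by_contra! hcon
      have h5 : (B a).card * (2 * U.card) ≤ 2 * Z.card * (2 * U.card) := by gcongr
      have h6 : 0 < Z.card := by omega
      nlinarith
    obtain ⟨X, hX, hXc⟩ := Finset.exists_subset_card_eq (s := B a \ Z) (n := b) (by
      have h1 := Finset.le_card_sdiff Z (B a)
      have h2 := hb a (Finset.mem_insert_self _ _)
      omega)
    have hXB : X ⊆ B a := hX.trans Finset.sdiff_subset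
    have hdis : Disjoint U X := Finset.disjoint_left.2 fun x hx hx' => (hUa x hx).1 (hXB hx')
    have hXU : c * ∑ y ∈ X, (nbrIn H y U).card ≤ b * (4 * U.card) := by
      rw [Finset.mul_sum, ← hXc, ← smul_eq_mul (X.card)]
      refine Finset.sum_le_card_nsmul X _ _ fun y hy => ?_
      obtain ⟨h1, h2⟩ := Finset.mem_sdiff.1 (hX hy)
      by_contra! hcon
      exact h2 (Finset.mem_filter.2 ⟨h1, hcon⟩)
    have hXX : ∑ y ∈ X, (nbrIn H y X).card ≤ b * b := by
      rw [← hXc, ← smul_eq_mul (X.card)]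
      exact Finset.sum_le_card_nsmul X _ _ fun y _ => Finset.card_le_card (nbrIn_subset _ _ _)
    have hsplit : ∀ x, (nbrIn H x (U ∪ X)).card ≤ (nbrIn H x U).card + (nbrIn H x X).card :=
      fun x => by
        rw [nbrIn, Finset.filter_union]
        exact Finset.card_union_le _ _
    refine ⟨U ∪ X, ?_, ?_, ?_⟩
    · rw [Finset.biUnion_insert, Finset.union_comm]
      exact Finset.union_subset_union hXB hU
    · rw [Finset.card_union_of_disjoint hdis, hUc, hXc, Finset.card_insert_of_notMem has]
      ring
    · have h1 : ∑ x ∈ U ∪ X, (nbrIn H x (U ∪ X)).card ≤ ∑ x ∈ U, (nbrIn H x U).card +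
          2 * ∑ y ∈ X, (nbrIn H y U).card + ∑ y ∈ X, (nbrIn H y X).card := by
        refine (Finset.sum_le_sum fun x _ => hsplit x).trans (le_of_eq ?_)
        rw [Finset.sum_union hdis, Finset.sum_add_distrib, Finset.sum_add_distrib,
          sum_card_nbrIn_comm H U X]
        ring
      rw [Finset.card_insert_of_notMem has]
      rw [hUc] at hXU
      have h2 := Nat.mul_le_mul_left c h1
      have h3 := Nat.mul_le_mul_left c hXX
      nlinarith [Nat.zero_le (s.card * b ^ 2), Nat.zero_le (b ^ 2)]

/-- Rödl's theorem for graphs without a hatted five-cycle: every large set contains a linear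
part that is very sparse in `G` or in its complement. -/
theorem exists_sparse_subset (L : ℕ) (hL : 0 < L) : ∃ M : ℕ, 0 < M ∧
    ∀ {V : Type} {G : SimpleGraph V}, NoHat G → ∀ S : Finset V, M ≤ S.card →
      ∃ X ⊆ S, S.card ≤ M * X.card ∧ ∃ H : SimpleGraph V, (H = G ∨ H = Gᶜ) ∧
        L * degBound H X ≤ X.card := by
  set c := 72 * L with hc
  have hc0 : 0 < c := by positivity
  set K := (24 * c ^ 6) ^ (2 * c) with hK
  have hK0 : 0 < K := by positivity
  refine ⟨4 * K, by positivity, fun {V G} hG S hS => ?_⟩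
  obtain ⟨B, H', hB, hsp⟩ := exists_sparse_chain hG hc0 (2 * c) S (by omega)
  rw [← hK] at hB
  set b := S.card / (2 * K) with hb
  have hb1 : 2 * K * b ≤ S.card := Nat.mul_div_le _ _
  have hb2 : S.card < 2 * K * (b + 1) := Nat.lt_mul_div_succ _ (by positivity)
  have hb0 : 0 < b := Nat.div_pos (by omega) (by positivity)
  have hSb : S.card ≤ 4 * K * b := by nlinarith
  obtain ⟨H, hH, I, hI, hIc, hIH⟩ : ∃ H : SimpleGraph V, (H = G ∨ H = Gᶜ) ∧
      ∃ I ⊆ Finset.range (2 * c), I.card = c ∧ ∀ i ∈ I, H' i = H := by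
    have hsplit := Finset.card_filter_add_card_filter_not (s := Finset.range (2 * c))
      fun i => H' i = G
    rw [Finset.card_range] at hsplit
    rcases Nat.lt_or_ge ((Finset.range (2 * c)).filter fun i => H' i = G).card c with h | h
    · obtain ⟨I, hI, hIc⟩ := Finset.exists_subset_card_eq
        (s := (Finset.range (2 * c)).filter fun i => ¬ H' i = G) (n := c) (by omega)
      refine ⟨Gᶜ, Or.inr rfl, I, hI.trans (Finset.filter_subset _ _), hIc, fun i hi => ?_⟩
      obtain ⟨h1, h2⟩ := Finset.mem_filter.1 (hI hi)
      exact (hB i (Finset.mem_range.1 h1)).2.2.resolve_left h2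
    · obtain ⟨I, hI, hIc⟩ := Finset.exists_subset_card_eq h
      exact ⟨G, Or.inl rfl, I, hI.trans (Finset.filter_subset _ _), hIc, fun i hi =>
        (Finset.mem_filter.1 (hI hi)).2⟩
  have hI' : ∀ i ∈ I, i < 2 * c := fun i hi => Finset.mem_range.1 (hI hi)
  obtain ⟨U, hU, hUc, hUe⟩ := exists_union_few_edges H B c b I
    (fun i hi => by
      have h1 := (hB i (hI' i hi)).2.1
      refine le_of_mul_le_mul_left (a := K) ?_ hK0
      linarith)
    (fun j hj i hi hij => by
      have := hsp j (hI' j hj) i hij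
      rwa [hIH i hi] at this)
  rw [hIc] at hUc hUe
  have hUe' : c * ∑ x ∈ U, (nbrIn H x U).card ≤ 9 * U.card ^ 2 := by
    refine hUe.trans (le_of_eq ?_)
    rw [hUc]; ring
  set X := U.filter fun x => c * (nbrIn H x U).card ≤ 18 * U.card with hX
  have hXc : U.card ≤ 2 * X.card := by
    have h1 := Finset.card_filter_add_card_filter_not (s := U)
      fun x => c * (nbrIn H x U).card ≤ 18 * U.card
    set Z := U.filter fun x => ¬ c * (nbrIn H x U).card ≤ 18 * U.card
    have h2 : Z.card * (18 * U.card) ≤ ∑ x ∈ Z, c * (nbrIn H x U).card := by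
      simpa using Finset.card_nsmul_le_sum Z _ (18 * U.card) fun y hy =>
        (not_le.1 (Finset.mem_filter.1 hy).2).le
    have h3 : ∑ x ∈ Z, c * (nbrIn H x U).card ≤ c * ∑ x ∈ U, (nbrIn H x U).card := by
      rw [Finset.mul_sum]
      exact Finset.sum_le_sum_of_subset (Finset.filter_subset _ _)
    have h4 : 0 < U.card := by rw [hUc]; positivity
    have h5 : 2 * Z.card ≤ U.card := by
      refine le_of_mul_le_mul_right (a := 9 * U.card) ?_ (by positivity)
      nlinarith
    change X.card + Z.card = U.card at h1
    omega
  have hcb : 72 * L * b ≤ 2 * X.card := by rw [← hc, ← hUc]; exact hXc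
  have hLb : L ≤ L * b := Nat.le_mul_of_pos_right _ hb0
  have hbL : b ≤ L * b := Nat.le_mul_of_pos_left _ hL
  have hXn : X.Nonempty := Finset.card_pos.1 (by nlinarith)
  refine ⟨X, (Finset.filter_subset _ _).trans (hU.trans (Finset.biUnion_subset.2 fun i hi =>
    (hB i (hI' i hi)).1)), hSb.trans (Nat.mul_le_mul_left _ (by nlinarith)), H, hH, ?_⟩
  obtain ⟨v, hv, hvd⟩ := exists_degBound_eq H hXn
  have h1 := (Finset.mem_filter.1 hv).2
  have h2 : (nbrIn H v X).card ≤ (nbrIn H v U).card :=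
    Finset.card_le_card (nbrIn_mono H v (Finset.filter_subset _ _))
  have h3 : c * (nbrIn H v X).card ≤ 36 * X.card :=
    (Nat.mul_le_mul_left _ h2).trans (by omega)
  rw [hc] at h3
  rw [hvd]
  nlinarith

/-! ### Large stable sets and cliques -/

/-- Stable sets and cliques in the members of a blockade combine: the union of the stable sets
is stable, so the product of the two sizes grows by a factor `q`. -/
theorem exists_isIndepSet_isClique_of_blockade {V : Type} (H : SimpleGraph V) {q : ℕ}
    (hq : 0 < q) (X A B : Fin q → Finset V) (hA : ∀ i, A i ⊆ X i)
    (hX : ∀ i j, i ≠ j → Disjoint (X i) (X j) ∧ ∀ x ∈ X i, ∀ y ∈ X j, ¬ H.Adj x y)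
    (hAi : ∀ i, H.IsIndepSet (A i : Set V)) :
    ∃ i₀ i₁, H.IsIndepSet ((Finset.univ.biUnion A : Finset V) : Set V) ∧
      q * ((A i₀).card * (B i₀).card) ≤ (Finset.univ.biUnion A).card * (B i₁).card := by
  have hne : (Finset.univ : Finset (Fin q)).Nonempty := ⟨⟨0, hq⟩, Finset.mem_univ _⟩
  obtain ⟨i₀, -, h₀⟩ := Finset.exists_min_image Finset.univ
    (fun i => (A i).card * (B i).card) hne
  obtain ⟨i₁, -, h₁⟩ := Finset.exists_max_image Finset.univ (fun i => (B i).card) hne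
  refine ⟨i₀, i₁, ?_, ?_⟩
  · intro x hx y hy hxy
    obtain ⟨i, -, hx⟩ := Finset.mem_biUnion.1 (Finset.mem_coe.1 hx)
    obtain ⟨j, -, hy⟩ := Finset.mem_biUnion.1 (Finset.mem_coe.1 hy)
    by_cases hij : i = j
    · subst hij
      exact hAi i hx hy hxy
    · exact (hX i j hij).2 x (hA i hx) y (hA j hy)
  · rw [Finset.card_biUnion fun i _ j _ hij =>
      ((hX i j hij).1.mono_left (hA i)).mono_right (hA j), Finset.sum_mul]
    calc q * ((A i₀).card * (B i₀).card)
        = ∑ _i : Fin q, (A i₀).card * (B i₀).card := by simp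
      _ ≤ ∑ i, (A i).card * (B i).card := Finset.sum_le_sum fun i hi => h₀ i hi
      _ ≤ ∑ i, (A i).card * (B i₁).card :=
        Finset.sum_le_sum fun i hi => Nat.mul_le_mul_left _ (h₁ i hi)

theorem exists_isIndepSet_isClique_of_nonempty {V : Type} {G : SimpleGraph V}
    {S : Finset V} (hS : S.Nonempty) : ∃ A ⊆ S, ∃ B ⊆ S, G.IsIndepSet (A : Set V) ∧
      G.IsClique (B : Set V) ∧ 1 ≤ A.card * B.card ∧ (2 ≤ S.card → 2 ≤ A.card * B.card) := by
  obtain ⟨x, hx⟩ := hS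
  rcases Nat.lt_or_ge S.card 2 with h | h
  · exact ⟨{x}, by simpa, {x}, by simpa, by simp, by simp, by simp, fun h' => by omega⟩
  obtain ⟨x, hx, y, hy, hxy⟩ := Finset.one_lt_card.1 (show 1 < S.card by omega)
  have hxyS : ({x, y} : Finset V) ⊆ S := by
    intro z hz
    simp only [Finset.mem_insert, Finset.mem_singleton] at hz
    rcases hz with rfl | rfl <;> assumption
  by_cases ha : G.Adj x y
  · refine ⟨{x}, by simpa, {x, y}, hxyS, by simp, ?_, ?_⟩
    · simpa [SimpleGraph.isClique_insert] using fun _ => ha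
    · rw [Finset.card_pair hxy]; simp
  · refine ⟨{x, y}, hxyS, {x}, by simpa, ?_, by simp, ?_⟩
    · rw [Finset.coe_pair, SimpleGraph.IsIndepSet, Set.pairwise_pair]
      exact fun _ => ⟨ha, fun h => ha h.symm⟩
    · rw [Finset.card_pair hxy]; simp

/-- The Erdős–Hajnal property in product form: a blockade, in `G` or in `Gᶜ`, reduces the claim
for `S` to smaller sets. -/
theorem exists_isIndepSet_isClique : ∃ C : ℕ, 0 < C ∧ ∀ {V : Type} {G : SimpleGraph V},
    NoHat G → NoHat Gᶜ → ∀ S : Finset V, S.Nonempty → ∃ A ⊆ S, ∃ B ⊆ S, G.IsIndepSet (A : Set V) ∧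
      G.IsClique (B : Set V) ∧ S.card ≤ (A.card * B.card) ^ C := by
  obtain ⟨M, hM0, hM⟩ := exists_sparse_subset (2 ^ 108) (by positivity)
  -- `216` and `665` are the exponents of `exists_hasBlockade_of_sparse`
  obtain ⟨K, hK⟩ : ∃ K, K = 216 + 665 := ⟨_, rfl⟩
  refine ⟨M + K, by omega, fun {V G} hG hGc S => ?_⟩
  induction hn : S.card using Nat.strong_induction_on generalizing S with
  | _ n ih =>
  intro hS
  subst hn
  rcases Nat.lt_or_ge S.card M with hsmall | hbig
  · obtain ⟨A, hA, B, hB, hAi, hBi, h1, h2⟩ := exists_isIndepSet_isClique_of_nonempty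
      (G := G) hS
    refine ⟨A, hA, B, hB, hAi, hBi, ?_⟩
    rcases Nat.lt_or_ge S.card 2 with h | h
    · exact le_trans (by omega) (Nat.one_le_pow _ _ h1)
    · calc S.card ≤ 2 ^ M := (hsmall.trans Nat.lt_two_pow_self).le
        _ ≤ 2 ^ (M + K) := Nat.pow_le_pow_right (by omega) (by omega)
        _ ≤ _ := Nat.pow_le_pow_left (h2 h) _
  obtain ⟨X, hXS, hXc, H, hH, hHX⟩ := hM hG S hbig
  have hHn : NoHat H := by rcases hH with rfl | rfl <;> assumption
  obtain ⟨q, hq, T, hTX, hTc, Y, hYT, hYc, hY⟩ := exists_hasBlockade_of_sparse hHn X hHX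
  have hSY : ∀ i, S.card ≤ q ^ (M + K) * (Y i).card := fun i => by
    have h1 : M ≤ q ^ M := Nat.lt_two_pow_self.le.trans (Nat.pow_le_pow_left hq M)
    calc S.card ≤ M * X.card := hXc
      _ ≤ q ^ M * (q ^ 216 * (q ^ 665 * (Y i).card)) := by
        gcongr
        exact hTc.trans (Nat.mul_le_mul_left _ (hYc i))
      _ = q ^ (M + (216 + 665)) * (Y i).card := by
        rw [pow_add, pow_add]
        simp only [mul_assoc]
      _ = _ := by rw [hK]
  have hYS : ∀ i, Y i ⊆ S := fun i => (hYT i).trans (hTX.trans hXS)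
  have hYn : ∀ i, (Y i).Nonempty := fun i => by
    rw [Finset.nonempty_iff_ne_empty]
    intro h
    have h1 := hSY i
    rw [h, Finset.card_empty, mul_zero] at h1
    have := hS.card_pos
    omega
  have hYlt : ∀ i, (Y i).card < S.card := fun i => by
    obtain ⟨j, hj⟩ : ∃ j : Fin q, i ≠ j := by
      by_cases h : i.val = 0
      · exact ⟨⟨1, by omega⟩, fun e => by rw [e] at h; simp at h⟩
      · exact ⟨⟨0, by omega⟩, fun e => h (by rw [e])⟩
    have h1 := Finset.card_le_card (Finset.union_subset (hYS i) (hYS j))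
    rw [Finset.card_union_of_disjoint (hY i j hj).1] at h1
    have := (hYn j).card_pos
    omega
  choose A hA B hB hAi hBi hAB using fun i => ih _ (hYlt i) (Y i) rfl (hYn i)
  have final : ∀ {a b : ℕ} i, q * ((A i).card * (B i).card) ≤ a * b →
      S.card ≤ (a * b) ^ (M + K) := fun {a b} i h => by
    calc S.card ≤ q ^ (M + K) * (Y i).card := hSY i
      _ ≤ q ^ (M + K) * ((A i).card * (B i).card) ^ (M + K) := Nat.mul_le_mul_left _ (hAB i)
      _ = (q * ((A i).card * (B i).card)) ^ (M + K) := (mul_pow _ _ _).symm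
      _ ≤ _ := Nat.pow_le_pow_left h _
  rcases hH with rfl | rfl
  · obtain ⟨i₀, i₁, h1, h2⟩ := exists_isIndepSet_isClique_of_blockade H (by omega) Y A B hA
      hY hAi
    exact ⟨_, Finset.biUnion_subset.2 fun i _ => (hA i).trans (hYS i), B i₁,
      (hB i₁).trans (hYS i₁), h1, hBi i₁, final i₀ h2⟩
  · obtain ⟨i₀, i₁, h1, h2⟩ := exists_isIndepSet_isClique_of_blockade Gᶜ (by omega) Y B A hB
      hY fun i => by simpa using hBi i
    exact ⟨A i₁, (hA i₁).trans (hYS i₁), _,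
      Finset.biUnion_subset.2 fun i _ => (hB i).trans (hYS i), hAi i₁,
      (SimpleGraph.isIndepSet_compl G).1 h1, final i₀ (by rw [mul_comm (A i₀).card, mul_comm (A i₁).card]; exact h2)⟩

end

/-! ### The graphs of the theorem -/

instance {V : Type} (G : SimpleGraph V) (S : Set V) [DecidableRel G.Adj]
    [DecidablePred (· ∈ S)] : DecidableRel (addVertex G S).Adj
  | none, none => inferInstanceAs (Decidable False)
  | none, some v => inferInstanceAs (Decidable (v ∈ S))
  | some u, none => inferInstanceAs (Decidable (u ∈ S))
  | some u, some v => inferInstanceAs (Decidable (G.Adj u v))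

instance (n : ℕ) : DecidableRel (SimpleGraph.pathGraph n).Adj := fun _ _ =>
  decidable_of_iff _ SimpleGraph.pathGraph_adj.symm

instance (n : ℕ) : DecidableRel (SimpleGraph.cycleGraph n).Adj := fun _ _ =>
  decidable_of_iff _ SimpleGraph.cycleGraph_adj'.symm

instance (k : ℕ) : DecidableRel (cycleHat k).Adj :=
  inferInstanceAs (DecidableRel (addVertex (SimpleGraph.cycleGraph k)
    {i : Fin k | i.val = 0 ∨ i.val = 1}).Adj)

instance : DecidableRel bull.Adj :=
  inferInstanceAs (DecidableRel (addVertex (SimpleGraph.pathGraph 4)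
    {i : Fin 4 | i.val = 1 ∨ i.val = 2}).Adj)

theorem noHat_of_not_isIndContained {V : Type} {G : SimpleGraph V}
    (h : ¬ (cycleHat 5).IsIndContained G) : NoHat G := by
  intro c₀ c₁ c₂ c₃ c₄ x h01 h12 h23 h34 h40 h02 h03 h13 h14 h24 hx0 hx1 hx2 hx3 hx4
  set f : Option (Fin 5) → V := fun o => o.elim x ![c₀, c₁, c₂, c₃, c₄] with hf
  have hadj : ∀ a b, G.Adj (f a) (f b) ↔ (cycleHat 5).Adj a b := by
    rintro (_ | a) (_ | b)
    · exact iff_of_false G.irrefl (by decide)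
    · fin_cases b <;> first
        | exact iff_of_true (by assumption) (by decide)
        | exact iff_of_false (by assumption) (by decide)
    · fin_cases a <;> rw [SimpleGraph.adj_comm, SimpleGraph.adj_comm (cycleHat 5)] <;> first
        | exact iff_of_true (by assumption) (by decide)
        | exact iff_of_false (by assumption) (by decide)
    · fin_cases a <;> fin_cases b <;> first
        | exact iff_of_false G.irrefl (by decide)
        | exact iff_of_true (by assumption) (by decide)
        | exact iff_of_false (by assumption) (by decide)
        | (rw [SimpleGraph.adj_comm, SimpleGraph.adj_comm (cycleHat 5)]
           first
           | exact iff_of_true (by assumption) (by decide)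
           | exact iff_of_false (by assumption) (by decide))
  -- distinct vertices of the pattern have distinct neighbourhoods
  have hdist : ∀ a b, (∀ c, (cycleHat 5).Adj a c ↔ (cycleHat 5).Adj b c) → a = b := by decide
  refine h ⟨⟨⟨f, fun a b hab => hdist a b fun c => ?_⟩, hadj _ _⟩⟩
  rw [← hadj, ← hadj, hab]

/-- If every member of `F₂` contains a member of `F₁`, then `F₁`-free graphs are `F₂`-free. -/
theorem hasEHProperty_mono {F₁ F₂ : Set BundledGraph}
    (h : ∀ H ∈ F₂, ∃ H' ∈ F₁, H'.2.IsIndContained H.2) (hF : HasEHProperty F₂) :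
    HasEHProperty F₁ := by
  obtain ⟨τ, hτ, hE⟩ := hF
  refine ⟨τ, hτ, fun V _ G hG => hE V G fun H hH hHG => ?_⟩
  obtain ⟨H', hH', hc⟩ := h H hH
  exact hG H' hH' (hc.trans hHG)

theorem hasEHProperty_cycleHat_five : HasEHProperty
    {⟨_, cycleHat 5⟩, ⟨_, (cycleHat 5)ᶜ⟩} := by
  obtain ⟨C, hC0, hC⟩ := exists_isIndepSet_isClique
  refine ⟨1 / (2 * C : ℝ), by positivity, fun V _ G hfree => ?_⟩
  have hG : NoHat G := noHat_of_not_isIndContained (hfree ⟨_, cycleHat 5⟩ (by simp))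
  have hGc : NoHat Gᶜ := noHat_of_not_isIndContained fun h =>
    hfree ⟨_, (cycleHat 5)ᶜ⟩ (by simp) (by
      have := h.compl
      rwa [compl_compl] at this)
  rcases (Finset.univ : Finset V).eq_empty_or_nonempty with h0 | hne
  · rw [← Finset.card_univ, h0, Finset.card_empty, Nat.cast_zero,
      Real.zero_rpow (by positivity)]
    positivity
  obtain ⟨A, -, B, -, hA, hB, h⟩ := hC hG hGc Finset.univ hne
  set m := max G.indepNum G.cliqueNum
  have hAm : A.card ≤ m := le_max_of_le_left hA.card_le_indepNum
  have hBm : B.card ≤ m := le_max_of_le_right hB.card_le_cliqueNum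
  have hle : Fintype.card V ≤ m ^ (2 * C) := by
    calc Fintype.card V ≤ (A.card * B.card) ^ C := h
      _ ≤ (m * m) ^ C := Nat.pow_le_pow_left (Nat.mul_le_mul hAm hBm) _
      _ = m ^ (2 * C) := by rw [pow_mul, sq]
  calc (Fintype.card V : ℝ) ^ (1 / (2 * C : ℝ))
      ≤ ((m : ℝ) ^ (2 * C)) ^ (1 / (2 * C : ℝ)) := by
        gcongr
        exact_mod_cast hle
    _ = m := by
        rw [one_div, show (2 * C : ℝ) = ((2 * C : ℕ) : ℝ) by push_cast; ring]
        exact Real.pow_rpow_inv_natCast (by positivity) (by omega)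

/-- Deleting the vertex of the cycle opposite to the hatted edge leaves a bull. -/
theorem bull_isIndContained : bull.IsIndContained (cycleHat 5) :=
  ⟨⟨⟨fun o => o.map ![4, 0, 1, 2], by decide⟩, by decide⟩⟩

/-- The bull is self-complementary, so it is also contained in the complement. -/
theorem bull_isIndContained_compl : bull.IsIndContained (cycleHat 5)ᶜ :=
  ⟨⟨⟨fun o => o.map ![1, 4, 2, 0], by decide⟩, by decide⟩⟩

theorem pathGraph_isIndContained : (SimpleGraph.pathGraph 5).IsIndContained (cycleHat 5) :=
  ⟨⟨⟨![none, some 1, some 2, some 3, some 4], by decide⟩, by decide⟩⟩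

theorem cycleHat_four_isIndContained : (cycleHat 4).IsIndContained (cycleHat 5)ᶜ :=
  ⟨⟨⟨fun o => o.elim (some 2) ![none, some 4, some 1, some 3], by decide⟩, by decide⟩⟩

end ErdosHajnal

theorem theorem1p6 :
    ErdosHajnal.HasEHProperty
      {⟨_, ErdosHajnal.cycleHat 5⟩, ⟨_, (ErdosHajnal.cycleHat 5)ᶜ⟩} ∧
    ErdosHajnal.HasEHProperty {⟨_, ErdosHajnal.bull⟩} ∧
    ErdosHajnal.HasEHProperty
      {⟨_, ErdosHajnal.cycleHat 5⟩, ⟨_, (SimpleGraph.pathGraph 5)ᶜ⟩} ∧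
    ErdosHajnal.HasEHProperty
      {H | ∃ k : ℕ, 4 ≤ k ∧ H = ⟨_, ErdosHajnal.cycleHat k⟩} := by
  have main := ErdosHajnal.hasEHProperty_cycleHat_five
  refine ⟨main, ErdosHajnal.hasEHProperty_mono ?_ main, ErdosHajnal.hasEHProperty_mono ?_ main,
    ErdosHajnal.hasEHProperty_mono ?_ main⟩
  · rintro H (rfl | rfl)
    · exact ⟨_, rfl, ErdosHajnal.bull_isIndContained⟩
    · exact ⟨_, rfl, ErdosHajnal.bull_isIndContained_compl⟩
  · rintro H (rfl | rfl)
    · exact ⟨_, Or.inl rfl, SimpleGraph.IsIndContained.refl _⟩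
    · exact ⟨_, Or.inr rfl, ErdosHajnal.pathGraph_isIndContained.compl⟩
  · rintro H (rfl | rfl)
    · exact ⟨_, ⟨5, by omega, rfl⟩, SimpleGraph.IsIndContained.refl _⟩
    · exact ⟨_, ⟨4, le_rfl, rfl⟩, ErdosHajnal.cycleHat_four_isIndContained⟩
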